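/- For a prime $p$ let $\mathbb{Z}_p$ be the additive group of $p$-adic integers. Define the Monna map $\phi_p:\mathbb{Z}_p\to[0,1)$ by $\phi_p\big(\sum_{r\ge 0}z_rp^r\big)=\sum_{r\ge 0}z_rp^{-r-1} \pmod 1$ with digits $z_r\in\{0,\dots,p-1\}$; on nonnegative integers it is the radical inverse function in base $p$. Define $\phi_p^+:[0,1)\to\mathbb{Z}_p$ by $\phi_p^+\big(\sum_{r\ge 0}x_rp^{-r-1}\big)=\sum_{r\ge 0}x_rp^r$, where the finite expansion is used whenever there is one, and for $x,\sigma\in[0,1)$ put $x\oplus_p\sigma=\phi_p(\phi_p^+(x)+\phi_p^+(\sigma))$. For $\boldsymbol p=(p_1,\dots,p_s)$ with pairwise distinct primes $p_j$, let $\mathrm{Hal}_{\boldsymbol p}=(\boldsymbol x_n)_{n\ge 0}$, $\boldsymbol x_n=(\phi_{p_1}(n),\dots,\phi_{p_s}(n))$, be the Halton sequence, and for $\boldsymbol\sigma\in[0,1)^s$ let $\mathrm{Hal}_{\boldsymbol p,\boldsymbol\sigma}$ be the shifted sequence of the points $\boldsymbol x_n\oplus_{\boldsymbol p}\boldsymbol\sigma$,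 the shift $\oplus_{p_j}$ being applied in coordinate $j$. For weights $\gamma_j>0$ let $\mathcal{H}(K_{s,\boldsymbol\gamma})$ be the weighted anchored Sobolev space with anchor $\boldsymbol 1=(1,\dots,1)$: the continuous functions $f$ on $[0,1]^s$ such that for every $\mathfrak{u}\subseteq\{1,\dots,s\}$ the function $\boldsymbol x_{\mathfrak u}\mapsto f(\boldsymbol x_{\mathfrak u},\boldsymbol 1)$ (the coordinates outside $\mathfrak u$ are set to $1$) has a weak mixed derivative $\frac{\partial^{|\mathfrak u|}}{\partial \boldsymbol x_{\mathfrak u}}f(\boldsymbol x_{\mathfrak u},\boldsymbol 1)\in L_2([0,1]^{|\mathfrak u|})$, with norm $$\|f\|^2=\sum_{\mathfrak u\subseteq\{1,\dots,s\}}\ \prod_{j\in\mathfrak u}\gamma_j^{-1}\int_{[0,1]^{|\mathfrak u|}}\Big|\frac{\partial^{|\mathfrak u|}}{\partial \boldsymbol x_{\mathfrak u}}f(\boldsymbol x_{\mathfrak u},\boldsymbol 1)\Big|^2\,\mathrm d\boldsymbol x_{\mathfrak u}.$$ For a sequence $\mathcal S=(\boldsymbol y_n)_{n\ge 0}$ in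 $[0,1)^s$ let $$e_{N,s}(\mathcal S,K_{s,\boldsymbol\gamma})=\sup_{\|f\|\le 1}\Big|\int_{[0,1]^s}f(\boldsymbol x)\,\mathrm d\boldsymbol x-\frac1N\sum_{n=0}^{N-1}f(\boldsymbol y_n)\Big|$$ be the worst-case error, and let $\widehat e_{N,s}(\mathrm{Hal}_{\boldsymbol p},K_{s,\boldsymbol\gamma})=\big(\mathbb{E}_{\boldsymbol\sigma}[e_{N,s}^2(\mathrm{Hal}_{\boldsymbol p,\boldsymbol\sigma},K_{s,\boldsymbol\gamma})]\big)^{1/2}$ be the root mean square worst-case error, where $\boldsymbol\sigma$ is uniformly distributed in $[0,1)^s$. **Theorem.** For every $s$, all pairwise distinct primes $p_1,\dots,p_s$, all weights $\gamma_1,\dots,\gamma_s>0$ and every integer $N\ge 1$, $$\widehat e_{N,s}(\mathrm{Hal}_{\boldsymbol p},K_{s,\boldsymbol\gamma})^2\le\frac1{N^2}\left[\prod_{j=1}^s\left(1+\gamma_j(\log N)\frac{p_j^2}{\log p_j}\right)+\prod_{j=1}^s\left(1+\frac{\gamma_j}2\right)\prod_{j=1}^s\left(1+\frac{\gamma_jp_j}6\right)\right].$$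 In particular, if $(p_j)_{j\ge 1}$ is a sequence of pairwise distinct primes and $(\gamma_j)_{j\ge 1}$ a sequence of positive weights with $\sum_{j=1}^\infty\gamma_j\frac{p_j^2}{\log p_j}<\infty$, then for every $\delta>0$ there is a constant $C>0$, depending only on $\delta$, $(\gamma_j)$ and $(p_j)$ and not on $s$ or $N$, such that for all $s$ and all $N\ge 1$, with $\boldsymbol p=(p_1,\dots,p_s)$ and $\boldsymbol\gamma=(\gamma_1,\dots,\gamma_s)$, $$\widehat e_{N,s}(\mathrm{Hal}_{\boldsymbol p},K_{s,\boldsymbol\gamma})\le\frac{C}{N^{1-\delta}}.$$ -/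

import Mathlib

open MeasureTheory
open scoped ENNReal

noncomputable section

namespace PadicHalton

/-! ### Halton sequences -/

/-- The radical inverse `n₀/p + n₁/p² + n₂/p³ + ⋯` of `n = n₀ + n₁ p + n₂ p² + ⋯`. -/
def radicalInverse (p n : ℕ) : ℝ :=
  ∑' r : ℕ, ((n / p ^ r % p : ℕ) : ℝ) / (p : ℝ) ^ (r + 1)

/-- The Halton sequence in bases `p j`. -/
def halton {s : ℕ} (p : Fin s → ℕ) (n : ℕ) : Fin s → ℝ :=
  fun j => radicalInverse (p j) n

/-! ### The `p`-adic shift -/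

/-- The digit `z_r` of the `p`-adic integer `z = z₀ + z₁ p + z₂ p² + ⋯`
(`z.appr (r + 1)` is the residue of `z` modulo `p ^ (r + 1)` in `[0, p ^ (r + 1))`). -/
def padicDigit {p : ℕ} [Fact p.Prime] (z : ℤ_[p]) (r : ℕ) : ℕ :=
  z.appr (r + 1) / p ^ r

/-- The Monna map, `z₀ + z₁ p + ⋯ ↦ z₀/p + z₁/p² + ⋯ (mod 1)`. -/
def monna (p : ℕ) [Fact p.Prime] (z : ℤ_[p]) : ℝ :=
  Int.fract (∑' r : ℕ, (padicDigit z r : ℝ) / (p : ℝ) ^ (r + 1))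

/-- The digit `x_r` in `x = x₀/p + x₁/p² + ⋯`, for `x ∈ [0,1)`. The floor function gives the
finite expansion if `x` has one. -/
def realDigit (p : ℕ) (x : ℝ) (r : ℕ) : ℕ :=
  ⌊x * (p : ℝ) ^ (r + 1)⌋₊ % p

/-- The map `x₀/p + x₁/p² + ⋯ ↦ x₀ + x₁ p + ⋯` from `[0,1)` to the `p`-adic integers. -/
def monnaInv (p : ℕ) [Fact p.Prime] (x : ℝ) : ℤ_[p] :=
  ∑' r : ℕ, (realDigit p x r : ℤ_[p]) * (p : ℤ_[p]) ^ r

/-- The one-dimensional `p`-adic shift `x ⊕ σ`, with the addition taken in `ℤ_[p]`. -/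
def padicShift (p : ℕ) [Fact p.Prime] (x σ : ℝ) : ℝ :=
  monna p (monnaInv p x + monnaInv p σ)

/-- The Halton sequence shifted by `σ ∈ [0,1)^s`. -/
def shiftedHalton {s : ℕ} (p : Fin s → ℕ) [∀ j, Fact (p j).Prime] (σ : Fin s → ℝ) (n : ℕ) :
    Fin s → ℝ :=
  fun j => padicShift (p j) (halton p n j) (σ j)

/-! ### The weighted anchored Sobolev space -/

section Derivatives

variable {ι : Type} [Fintype ι] [DecidableEq ι]

/-- The partial derivative in the coordinate `j`. -/
def partialDeriv (j : ι) (φ : (ι → ℝ) → ℝ) : (ι → ℝ) → ℝ :=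
  fun x => deriv (fun t => φ (Function.update x j t)) (x j)

/-- The mixed derivative of order one in every coordinate. It is applied to smooth functions only,
for which the order of the differentiations does not matter. -/
def mixedDeriv (φ : (ι → ℝ) → ℝ) : (ι → ℝ) → ℝ :=
  (Finset.univ : Finset ι).toList.foldr partialDeriv φ

/-- Smooth functions with compact support in the open unit cube. -/
def IsTestFunction (φ : (ι → ℝ) → ℝ) : Prop :=
  ContDiff ℝ (⊤ : ℕ∞) φ ∧ HasCompactSupport φ ∧
    tsupport φ ⊆ Set.univ.pi (fun _ => Set.Ioo (0 : ℝ) 1)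

/-- `g` is the weak mixed derivative of `F` (order one in every coordinate) on the unit cube. -/
def IsWeakMixedDeriv (F g : (ι → ℝ) → ℝ) : Prop :=
  ∀ φ : (ι → ℝ) → ℝ, IsTestFunction φ →
    ∫ x in Set.Icc (0 : ι → ℝ) 1, F x * mixedDeriv φ x =
      (-1) ^ Fintype.card ι * ∫ x in Set.Icc (0 : ι → ℝ) 1, g x * φ x

end Derivatives

/-- The section `x_u ↦ f (x_u, 1)`: the coordinates outside `u` are set to `1`. -/
def anchoredSection {s : ℕ} (u : Finset (Fin s)) (f : (Fin s → ℝ) → ℝ) : (u → ℝ) → ℝ :=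
  fun y => f (fun j => if h : j ∈ u then y ⟨j, h⟩ else 1)

/-- `g` is a square integrable weak derivative `∂^{|u|}/∂x_u` of `x_u ↦ f (x_u, 1)`. -/
def IsAnchoredDeriv {s : ℕ} (f : (Fin s → ℝ) → ℝ) (u : Finset (Fin s)) (g : (u → ℝ) → ℝ) : Prop :=
  MemLp g 2 (volume.restrict (Set.Icc (0 : u → ℝ) 1)) ∧
    IsWeakMixedDeriv (anchoredSection u f) g

/-- Membership in the Sobolev space with anchor `(1,…,1)`: continuous functions on `[0,1]^s` all of
whose derivatives `∂^{|u|}/∂x_u f (x_u, 1)` are square integrable. Only the values of `f` on the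
closed unit cube matter. -/
def MemSobolev {s : ℕ} (f : (Fin s → ℝ) → ℝ) : Prop :=
  ContinuousOn f (Set.Icc 0 1) ∧ ∀ u : Finset (Fin s), ∃ g, IsAnchoredDeriv f u g

open Classical in
/-- The derivative `∂^{|u|}/∂x_u f (x_u, 1)`, unique up to null sets in the unit cube; `0` if there
is no square integrable one. -/
def anchoredDeriv {s : ℕ} (f : (Fin s → ℝ) → ℝ) (u : Finset (Fin s)) : (u → ℝ) → ℝ :=
  if h : ∃ g, IsAnchoredDeriv f u g then h.choose else 0

/-- The inner product of the Sobolev space with product weights. -/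
def sobolevInner {s : ℕ} (γ : Fin s → ℝ) (f g : (Fin s → ℝ) → ℝ) : ℝ :=
  ∑ u : Finset (Fin s), (∏ j ∈ u, γ j)⁻¹ *
    ∫ x in Set.Icc (0 : u → ℝ) 1, anchoredDeriv f u x * anchoredDeriv g u x

/-- The norm of the Sobolev space with product weights. -/
def sobolevNorm {s : ℕ} (γ : Fin s → ℝ) (f : (Fin s → ℝ) → ℝ) : ℝ :=
  Real.sqrt (sobolevInner γ f f)

/-! ### Integration errors -/

/-- The worst-case error, over the unit ball of the Sobolev space, of the equal-weight quadrature
rule with nodes `S 0, …, S (N - 1)`. -/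
def worstCaseError {s : ℕ} (γ : Fin s → ℝ) (S : ℕ → Fin s → ℝ) (N : ℕ) : ℝ≥0∞ :=
  ⨆ (f : (Fin s → ℝ) → ℝ) (_ : MemSobolev f ∧ sobolevNorm γ f ≤ 1),
    ENNReal.ofReal
      |(∫ x in Set.Icc (0 : Fin s → ℝ) 1, f x) - (1 / (N : ℝ)) * ∑ n ∈ Finset.range N, f (S n)|

/-- The root mean square worst-case error of the randomly shifted Halton sequence, the shift being
uniformly distributed in `[0,1)^s`. -/
def rmsError {s : ℕ} (p : Fin s → ℕ) [∀ j, Fact (p j).Prime] (γ : Fin s → ℝ) (N : ℕ) : ℝ≥0∞ :=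
  (∫⁻ σ in Set.univ.pi (fun _ : Fin s => Set.Ico (0 : ℝ) 1),
    worstCaseError γ (shiftedHalton p σ) N ^ 2) ^ (1 / 2 : ℝ)

end PadicHalton

end

namespace PadicHalton

open Filter Topology

/-! ### The uniform measure on the unit cube -/

/-! Duality. Testing the weak derivatives against smooth approximations of box indicators
(`sum_corners_eq_integral`) and inverting over subsets of coordinates gives `f y = ∑ u, (-1)^|u| ∫
∂_u f(x_u, 1) ∏ 1[y_j < x_j]` on `[0,1)^s`. Hence the integration error pairs the derivatives with
the local discrepancies of the projections, and Cauchy-Schwarz bounds the squared worst-case error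
by the weighted sum of their squared L2 norms. Only this upper bound is needed, so no reproducing
kernel theory enters. Multiplying out the square leaves products of one-dimensional integrals.

Averaging. Adding a uniform shift to `φ_p(n)` amounts to adding a uniform `p`-adic integer to `n`.
To avoid any measurability question about the worst-case error, the shifted points are enclosed
between functions of the first `L` digits of the shift, the resulting step function is integrated,
and `L → ∞`. The mean of `1 - max(x, y)` over the shifts of the points with indices `n` and `m`
becomes `1/2 - halfDist(n - m)`, and summation over `u` turns the bound into a double sum of
products over `j` minus `N² ∏ (1 + γ_j/3)`, all divided by `N²`.

Cancellation. For `|k| < N ≤ p^g`, the kernel `1/2 - halfDist(k)` is `1/3` plus level terms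
`levelCoeff p r k`, `r < g`, plus a small correction present only at `k = 0`. A level term is
supported on multiples of `p^r`, has period `p^(r+1)`, is at most `p^(-r)/6`, and has mean zero
along progressions of step `p^r u` with `p ∤ u`. Multiply out the product over `j`. Choosing the
constant everywhere gives exactly the subtracted `N²` term. Any other choice, on a nonempty set `J`
of coordinates, has zero sum over a full period because the primes are distinct, so its double sum
is periodic in `N`; after reducing `N` modulo the period a trivial count bounds it by `∏_{j ∈ J}
min(p_j, N)²/6`, whatever the levels are. There are about `log N / log p_j` levels in coordinate
`j`, which produces the first product of the theorem; the diagonal correction produces the second.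

Tractability. In `∏ (1 + x_j log N)` with `x` summable, a tail of sum at most `δ` costs `N^δ`
through `1 + y ≤ exp y`, and each of the finitely many remaining logarithms is dominated by a small
power of `N`. -/

/-- The uniform distribution on the unit interval. -/
noncomputable def unitMeas : Measure ℝ := volume.restrict (Set.Ioo 0 1)

instance : IsProbabilityMeasure unitMeas := ⟨by simp [unitMeas]⟩

theorem unitMeas_eq_Icc : unitMeas = volume.restrict (Set.Icc 0 1) :=
  Measure.restrict_congr_set Ioo_ae_eq_Icc

theorem unitMeas_eq_Ico : unitMeas = volume.restrict (Set.Ico 0 1) :=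
  Measure.restrict_congr_set Ioo_ae_eq_Ico

theorem restrict_Icc_eq_pi {ι : Type*} [Fintype ι] :
    (volume : Measure (ι → ℝ)).restrict (Set.Icc 0 1) = Measure.pi fun _ => unitMeas := by
  rw [← Set.pi_univ_Icc, volume_pi, Measure.restrict_pi_pi, unitMeas_eq_Icc]; rfl

theorem restrict_Ico_eq_pi {ι : Type*} [Fintype ι] :
    (volume : Measure (ι → ℝ)).restrict (Set.univ.pi fun _ => Set.Ico 0 1) =
      Measure.pi fun _ => unitMeas := by
  rw [volume_pi, Measure.restrict_pi_pi, unitMeas_eq_Ico]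

theorem integral_unitMeas (f : ℝ → ℝ) : ∫ t, f t ∂unitMeas = ∫ t in (0 : ℝ)..1, f t := by
  rw [unitMeas, intervalIntegral.integral_of_le zero_le_one, integral_Ioc_eq_integral_Ioo]

theorem ae_pi_unitMeas {ι : Type*} [Fintype ι] :
    ∀ᵐ x : ι → ℝ ∂(Measure.pi fun _ => unitMeas), ∀ j, x j ∈ Set.Ioo (0 : ℝ) 1 := by
  have : (Measure.pi fun _ : ι => unitMeas) =
      (volume : Measure (ι → ℝ)).restrict (Set.univ.pi fun _ => Set.Ioo 0 1) := by
    rw [volume_pi, Measure.restrict_pi_pi]; rfl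
  rw [this]
  filter_upwards [ae_restrict_mem (MeasurableSet.univ_pi fun _ => measurableSet_Ioo)] with x hx j
  exact hx j (Set.mem_univ j)

/-! ### Smooth steps -/

/-- A smooth step from `0` at `c` to `1` at `c + e`. -/
noncomputable def smoothStep (c e t : ℝ) : ℝ := Real.smoothTransition ((t - c) / e)

theorem contDiff_smoothStep (c e : ℝ) : ContDiff ℝ (⊤ : ℕ∞) (smoothStep c e) :=
  Real.smoothTransition.contDiff.comp (by fun_prop)

theorem differentiable_smoothStep (c e : ℝ) : Differentiable ℝ (smoothStep c e) :=
  (contDiff_smoothStep c e).differentiable (by simp)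

theorem continuous_deriv_smoothStep (c e : ℝ) : Continuous (deriv (smoothStep c e)) :=
  (contDiff_smoothStep c e).continuous_deriv (by simp)

theorem smoothStep_nonneg (c e t : ℝ) : 0 ≤ smoothStep c e t := Real.smoothTransition.nonneg _

theorem smoothStep_le_one (c e t : ℝ) : smoothStep c e t ≤ 1 := Real.smoothTransition.le_one _

theorem smoothStep_of_le {c e t : ℝ} (he : 0 < e) (h : t ≤ c) : smoothStep c e t = 0 :=
  Real.smoothTransition.zero_of_nonpos (div_nonpos_of_nonpos_of_nonneg (by linarith) he.le)

theorem smoothStep_of_ge {c e t : ℝ} (he : 0 < e) (h : c + e ≤ t) : smoothStep c e t = 1 :=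
  Real.smoothTransition.one_of_one_le (by rw [le_div_iff₀ he]; linarith)

theorem monotone_smoothStep {c e : ℝ} (he : 0 < e) : Monotone (smoothStep c e) := fun s t h =>
  Real.smoothTransition.monotone (by gcongr)

theorem deriv_smoothStep_nonneg {c e : ℝ} (he : 0 < e) (t : ℝ) : 0 ≤ deriv (smoothStep c e) t :=
  (monotone_smoothStep he).deriv_nonneg

theorem mem_Icc_of_deriv_smoothStep_ne_zero {c e t : ℝ} (he : 0 < e)
    (h : deriv (smoothStep c e) t ≠ 0) : t ∈ Set.Icc c (c + e) := by
  by_contra hc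
  rw [Set.mem_Icc, not_and_or, not_le, not_le] at hc
  apply h
  rcases hc with hc | hc
  · have : smoothStep c e =ᶠ[𝓝 t] fun _ => 0 := by
      filter_upwards [Iio_mem_nhds hc] with x hx using smoothStep_of_le he (le_of_lt hx)
    rw [this.deriv_eq]; simp
  · have : smoothStep c e =ᶠ[𝓝 t] fun _ => 1 := by
      filter_upwards [Ioi_mem_nhds hc] with x hx using smoothStep_of_ge he (le_of_lt hx)
    rw [this.deriv_eq]; simp

theorem integral_deriv_smoothStep {c e : ℝ} (he : 0 < e) (h0 : 0 ≤ c) (h1 : c + e ≤ 1) :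
    ∫ t, deriv (smoothStep c e) t ∂unitMeas = 1 := by
  rw [integral_unitMeas, intervalIntegral.integral_deriv_eq_sub
    (fun t _ => differentiable_smoothStep c e t)
    ((continuous_deriv_smoothStep c e).intervalIntegrable _ _),
    smoothStep_of_ge he h1, smoothStep_of_le he h0, sub_zero]

/-- A smooth approximation of the indicator function of `[c, d + e]`. -/
noncomputable def smoothBump (c d e t : ℝ) : ℝ := smoothStep c e t - smoothStep d e t

theorem smoothBump_mem_Icc {c d e : ℝ} (he : 0 < e) (h : c + e ≤ d) (t : ℝ) :
    smoothBump c d e t ∈ Set.Icc 0 1 := by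
  unfold smoothBump
  rcases le_total t d with ht | ht
  · rw [smoothStep_of_le he ht, sub_zero]
    exact ⟨smoothStep_nonneg _ _ _, smoothStep_le_one _ _ _⟩
  · rw [smoothStep_of_ge he (h.trans ht)]
    constructor <;> linarith [smoothStep_nonneg d e t, smoothStep_le_one d e t]

theorem smoothBump_eq_one {c d e t : ℝ} (he : 0 < e) (h1 : c + e ≤ t) (h2 : t ≤ d) :
    smoothBump c d e t = 1 := by
  rw [smoothBump, smoothStep_of_le he h2, smoothStep_of_ge he h1, sub_zero]

theorem mem_Icc_of_smoothBump_ne_zero {c d e t : ℝ} (he : 0 < e) (hcd : c ≤ d)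
    (h : smoothBump c d e t ≠ 0) : t ∈ Set.Icc c (d + e) := by
  by_contra hc
  rw [Set.mem_Icc, not_and_or, not_le, not_le] at hc
  apply h
  unfold smoothBump
  rcases hc with hc | hc
  · rw [smoothStep_of_le he hc.le, smoothStep_of_le he (hc.le.trans hcd), sub_zero]
  · rw [smoothStep_of_ge he hc.le, smoothStep_of_ge he (by linarith), sub_self]

theorem deriv_smoothBump (c d e t : ℝ) :
    deriv (smoothBump c d e) t = deriv (smoothStep c e) t - deriv (smoothStep d e) t :=
  deriv_sub (differentiable_smoothStep c e t) (differentiable_smoothStep d e t)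

/-! ### Product test functions -/

section Product

variable {ι : Type} [Fintype ι]

theorem foldr_partialDeriv_prod [DecidableEq ι] (φ : ι → ℝ → ℝ) (l : List ι) (hl : l.Nodup) :
    l.foldr partialDeriv (fun x => ∏ j, φ j (x j)) =
      fun x => ∏ j, (if j ∈ l then deriv (φ j) else φ j) (x j) := by
  induction l with
  | nil => simp
  | cons i l ih =>
    rw [List.nodup_cons] at hl
    rw [List.foldr_cons, ih hl.2]
    funext x
    unfold partialDeriv
    have h1 : (fun t => ∏ j, (if j ∈ l then deriv (φ j) else φ j) (Function.update x i t j)) =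
        fun t => φ i t * ∏ j ∈ Finset.univ.erase i, (if j ∈ l then deriv (φ j) else φ j) (x j) := by
      funext t
      rw [← Finset.mul_prod_erase _ _ (Finset.mem_univ i)]
      congr 1
      · simp [hl.1]
      · refine Finset.prod_congr rfl fun j hj => ?_
        rw [Function.update_of_ne (Finset.ne_of_mem_erase hj)]
    rw [h1, deriv_mul_const_field, ← Finset.mul_prod_erase _ _ (Finset.mem_univ i)]
    congr 1
    · simp
    · refine Finset.prod_congr rfl fun j hj => ?_
      simp [Finset.ne_of_mem_erase hj]

theorem mixedDeriv_prod [DecidableEq ι] (φ : ι → ℝ → ℝ) :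
    mixedDeriv (fun x => ∏ j, φ j (x j)) = fun x => ∏ j, deriv (φ j) (x j) := by
  rw [mixedDeriv, foldr_partialDeriv_prod _ _ (Finset.nodup_toList _)]
  simp

theorem isTestFunction_prod {φ : ι → ℝ → ℝ} (hφ : ∀ j, ContDiff ℝ (⊤ : ℕ∞) (φ j)) {a b : ι → ℝ}
    (hs : ∀ j t, φ j t ≠ 0 → t ∈ Set.Icc (a j) (b j)) (ha : ∀ j, 0 < a j) (hb : ∀ j, b j < 1) :
    IsTestFunction (fun x : ι → ℝ => ∏ j, φ j (x j)) := by
  have hsub : Function.support (fun x : ι → ℝ => ∏ j, φ j (x j)) ⊆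
      Set.univ.pi fun j => Set.Icc (a j) (b j) := by
    intro x hx j _
    exact hs j _ fun h => hx (Finset.prod_eq_zero (Finset.mem_univ j) h)
  have hcomp : IsCompact (Set.univ.pi fun j => Set.Icc (a j) (b j)) :=
    isCompact_univ_pi fun j => isCompact_Icc
  have hts := closure_minimal hsub hcomp.isClosed
  refine ⟨?_, hcomp.of_isClosed_subset (isClosed_tsupport _) hts, ?_⟩
  · exact contDiff_prod fun j _ => (hφ j).comp (contDiff_apply ℝ ℝ j)
  · intro x hx j hj
    exact ⟨(ha j).trans_le (hts hx j hj).1, (hts hx j hj).2.trans_lt (hb j)⟩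

/-- A product approximate identity. The unit mass is measured inside the cube, so the concentration
point may lie on the boundary; this is needed for corners with coordinates equal to `1`. -/
theorem tendsto_integral_prod_peak {ρ : ℕ → ι → ℝ → ℝ} {F : (ι → ℝ) → ℝ} {x₀ : ι → ℝ}
    (hF : ContinuousOn F (Set.Icc 0 1)) (hx₀ : x₀ ∈ Set.Icc (0 : ι → ℝ) 1)
    (hc : ∀ n j, Continuous (ρ n j)) (hnn : ∀ n j t, 0 ≤ ρ n j t)
    (hint : ∀ n j, ∫ t, ρ n j t ∂unitMeas = 1)
    (hs : ∀ η > 0, ∀ᶠ n in atTop, ∀ j t, ρ n j t ≠ 0 → |t - x₀ j| < η) :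
    Tendsto (fun n => ∫ x in Set.Icc (0 : ι → ℝ) 1, (∏ j, ρ n j (x j)) * F x) atTop
      (𝓝 (F x₀)) := by
  change Tendsto (fun n => ∫ x in Set.Icc (0 : ι → ℝ) 1, (∏ j, ρ n j (x j)) • F x) atTop (𝓝 (F x₀))
  have hFi : IntegrableOn F (Set.Icc 0 1) volume := hF.integrableOn_compact isCompact_Icc
  refine tendsto_setIntegral_peak_smul_of_integrableOn_of_tendsto (x₀ := x₀) measurableSet_Icc
    measurableSet_Icc subset_rfl self_mem_nhdsWithin ?_ ?_ ?_ ?_ ?_ hFi (hF x₀ hx₀)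
  · exact isCompact_Icc.measure_lt_top.ne
  · exact Eventually.of_forall fun n x _ => Finset.prod_nonneg fun j _ => hnn n j _
  · intro u hu hxu
    obtain ⟨η, hη, hball⟩ := Metric.isOpen_iff.1 hu x₀ hxu
    rw [Metric.tendstoUniformlyOn_iff]
    intro e he
    filter_upwards [hs η hη] with n hn x hx
    suffices h : ∏ j, ρ n j (x j) = 0 by simpa [h] using he
    by_contra h
    refine hx.2 (hball ?_)
    rw [Metric.mem_ball, dist_pi_lt_iff hη]
    intro j
    exact hn j _ fun h0 => h (Finset.prod_eq_zero (Finset.mem_univ j) h0)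
  · refine tendsto_const_nhds.congr fun n => ?_
    rw [restrict_Icc_eq_pi, integral_fintype_prod_eq_prod]
    simp [hint]
  · refine Eventually.of_forall fun n => Continuous.aestronglyMeasurable ?_
    exact continuous_finsetProd _ fun j _ => (hc n j).comp (continuous_apply j)

/-- The mixed difference of a continuous function over the box `[y, 1]` is the integral of its weak
mixed derivative. -/
theorem sum_corners_eq_integral [DecidableEq ι] {F g : (ι → ℝ) → ℝ}
    (hF : ContinuousOn F (Set.Icc 0 1)) (hg : Integrable g (Measure.pi fun _ => unitMeas))
    (h : IsWeakMixedDeriv F g) {y : ι → ℝ}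
    (hy : ∀ j, y j ∈ Set.Ico (0 : ℝ) 1) :
    ∑ v : Finset ι, (-1) ^ v.card * F (fun j => if j ∈ v then y j else 1) =
      ∫ x, g x * ∏ j, (if y j < x j then 1 else 0) ∂(Measure.pi fun _ => unitMeas) := by
  -- The `4` gives `4e ≤ 1 - y`, so the rise on `[y + e, y + 2e]` ends before the fall on `[1 - 2e,
  -- 1 - e]` starts; the offsets by `e` keep the support in the open cube even if `y j = 0`.
  set e : ℕ → ι → ℝ := fun n j => (1 - y j) / (n + 4) with he
  have hepos : ∀ n j, 0 < e n j := fun n j => div_pos (by linarith [(hy j).2]) (by positivity)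
  have he4 : ∀ n j, 4 * e n j ≤ 1 - y j := by
    intro n j
    have : 0 < 1 - y j := by linarith [(hy j).2]
    rw [he]; simp only
    rw [mul_div_assoc', div_le_iff₀ (by positivity)]
    nlinarith [(Nat.cast_nonneg n : (0 : ℝ) ≤ n)]
  have hetend : ∀ j, Tendsto (fun n => e n j) atTop (𝓝 0) := by
    intro j
    refine Tendsto.div_atTop tendsto_const_nhds ?_
    exact tendsto_atTop_add_const_right _ _ tendsto_natCast_atTop_atTop
  have hesmall : ∀ η > 0, ∀ᶠ n in atTop, ∀ j, 2 * e n j < η := by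
    intro η hη
    rw [eventually_all]
    intro j
    filter_upwards [(hetend j).eventually (gt_mem_nhds (half_pos hη))] with n hn
    linarith
  -- The bump `φ` approximates the indicator of `(y, 1)`. Its derivative is `α - β`, with unit peaks
  -- `α` near `y` and `β` near `1`; multiplying out over the coordinates evaluates `F` at the
  -- corners of the box.
  set α : ℕ → ι → ℝ → ℝ := fun n j => deriv (smoothStep (y j + e n j) (e n j)) with hα
  set β : ℕ → ι → ℝ → ℝ := fun n j => deriv (smoothStep (1 - 2 * e n j) (e n j)) with hβ
  set φ : ℕ → ι → ℝ → ℝ := fun n j => smoothBump (y j + e n j) (1 - 2 * e n j) (e n j) with hφ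
  have hφI : ∀ n j t, φ n j t ∈ Set.Icc (0 : ℝ) 1 := fun n j t =>
    smoothBump_mem_Icc (hepos n j) (by linarith [he4 n j]) t
  have hφs : ∀ n j t, φ n j t ≠ 0 → t ∈ Set.Icc (y j + e n j) (1 - e n j) := by
    intro n j t ht
    have := mem_Icc_of_smoothBump_ne_zero (hepos n j) (by linarith [he4 n j, hepos n j]) ht
    exact ⟨this.1, by linarith [this.2]⟩
  have hφc : ∀ n j, ContDiff ℝ (⊤ : ℕ∞) (φ n j) := fun n j =>
    (contDiff_smoothStep _ _).sub (contDiff_smoothStep _ _)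
  have key : ∀ n, ∑ v : Finset ι, (-1) ^ v.card *
      ∫ x in Set.Icc (0 : ι → ℝ) 1, (∏ j, (if j ∈ v then α n j else β n j) (x j)) * F x =
      ∫ x, g x * ∏ j, φ n j (x j) ∂(Measure.pi fun _ => unitMeas) := by
    intro n
    have h1 := h _ (isTestFunction_prod (hφc n) (hφs n)
      (fun j => by linarith [(hy j).1, hepos n j]) (fun j => by linarith [hepos n j]))
    rw [mixedDeriv_prod, restrict_Icc_eq_pi (ι := ι)] at h1
    have h2 : ∀ x : ι → ℝ, F x * ∏ j, deriv (φ n j) (x j) = (-1) ^ Fintype.card ι *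
        ∑ v : Finset ι, (-1) ^ v.card *
          ((∏ j, (if j ∈ v then α n j else β n j) (x j)) * F x) := by
      intro x
      -- One sign per coordinate is pulled out so that it cancels the `(-1) ^ card ι` in the
      -- definition of the weak derivative.
      have h3 : ∀ j, deriv (φ n j) (x j) = -1 * (-1 * α n j (x j) + β n j (x j)) := by
        intro j
        rw [hφ]; simp only
        rw [deriv_smoothBump]; simp only [hα, hβ]; ring
      rw [Finset.prod_congr rfl fun j _ => h3 j, Finset.prod_mul_distrib, Fintype.prod_add,
        Finset.prod_const, Finset.card_univ, Finset.mul_sum, Finset.mul_sum, Finset.mul_sum]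
      refine Finset.sum_congr rfl fun v _ => ?_
      have h4 : ∏ j, (if j ∈ v then α n j else β n j) (x j) =
          (∏ j ∈ v, α n j (x j)) * ∏ j ∈ vᶜ, β n j (x j) := by
        rw [← Finset.prod_mul_prod_compl v]
        congr 1
        · exact Finset.prod_congr rfl fun j hj => by rw [if_pos hj]
        · exact Finset.prod_congr rfl fun j hj => by rw [if_neg (Finset.mem_compl.1 hj)]
      rw [h4, Finset.prod_mul_distrib, Finset.prod_const]
      ring
    simp_rw [h2] at h1
    rw [integral_const_mul, integral_finsetSum] at h1
    · have h5 : ((-1 : ℝ) ^ Fintype.card ι) ≠ 0 := by simp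
      have h6 := mul_left_cancel₀ h5 h1
      rw [← h6, restrict_Icc_eq_pi]
      exact Finset.sum_congr rfl fun v _ => (integral_const_mul _ _).symm
    · intro v _
      refine Integrable.const_mul ?_ _
      rw [← restrict_Icc_eq_pi]
      refine ContinuousOn.integrableOn_compact isCompact_Icc (ContinuousOn.mul ?_ hF)
      refine Continuous.continuousOn (continuous_finsetProd _ fun j _ => ?_)
      refine Continuous.comp (g := if j ∈ v then α n j else β n j) ?_ (continuous_apply j)
      split_ifs <;> exact continuous_deriv_smoothStep _ _
  have lim1 : Tendsto (fun n => ∑ v : Finset ι, (-1) ^ v.card *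
      ∫ x in Set.Icc (0 : ι → ℝ) 1, (∏ j, (if j ∈ v then α n j else β n j) (x j)) * F x) atTop
      (𝓝 (∑ v : Finset ι, (-1) ^ v.card * F (fun j => if j ∈ v then y j else 1))) := by
    refine tendsto_finsetSum _ fun v _ => Tendsto.const_mul _ ?_
    refine tendsto_integral_prod_peak hF ?_ ?_ ?_ ?_ ?_
    · constructor <;> intro j <;> simp only <;> split_ifs <;> simp [(hy j).1, (hy j).2.le]
    · intro n j; split_ifs <;> exact continuous_deriv_smoothStep _ _
    · intro n j t; split_ifs <;> exact deriv_smoothStep_nonneg (hepos n j) t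
    · intro n j
      split_ifs
      · exact integral_deriv_smoothStep (hepos n j) (by linarith [(hy j).1, hepos n j])
          (by linarith [he4 n j, hepos n j])
      · exact integral_deriv_smoothStep (hepos n j) (by linarith [(hy j).1, he4 n j, hepos n j])
          (by linarith [hepos n j])
    · intro η hη
      filter_upwards [hesmall η hη] with n hn j t ht
      split_ifs at ht ⊢ with hj
      · have := mem_Icc_of_deriv_smoothStep_ne_zero (hepos n j) ht
        rw [abs_lt]; constructor <;> linarith [this.1, this.2, hn j, hepos n j]
      · have := mem_Icc_of_deriv_smoothStep_ne_zero (hepos n j) ht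
        rw [abs_lt]; constructor <;> linarith [this.1, this.2, hn j, hepos n j]
  have lim2 : Tendsto (fun n => ∫ x, g x * ∏ j, φ n j (x j) ∂(Measure.pi fun _ => unitMeas)) atTop
      (𝓝 (∫ x, g x * ∏ j, (if y j < x j then 1 else 0) ∂(Measure.pi fun _ => unitMeas))) := by
    refine tendsto_integral_of_dominated_convergence (fun x => ‖g x‖) ?_ hg.norm ?_ ?_
    · intro n
      refine hg.1.mul (Continuous.aestronglyMeasurable ?_)
      exact continuous_finsetProd _ fun j _ => (hφc n j).continuous.comp (continuous_apply j)
    · refine fun n => Eventually.of_forall fun x => ?_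
      rw [norm_mul]
      refine mul_le_of_le_one_right (norm_nonneg _) ?_
      rw [Real.norm_of_nonneg (Finset.prod_nonneg fun j _ => (hφI n j _).1)]
      exact Finset.prod_le_one (fun j _ => (hφI n j _).1) fun j _ => (hφI n j _).2
    · filter_upwards [ae_pi_unitMeas] with x hx
      refine Tendsto.const_mul _ (tendsto_finsetProd _ fun j _ => ?_)
      refine tendsto_const_nhds.congr' ?_
      split_ifs with hj
      · filter_upwards [(hetend j).eventually (gt_mem_nhds (show 0 < (x j - y j) / 2 by linarith)),
          (hetend j).eventually (gt_mem_nhds (show 0 < (1 - x j) / 2 by linarith [(hx j).2]))]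
          with n h1 h2
        exact (smoothBump_eq_one (hepos n j) (by linarith) (by linarith)).symm
      · refine Eventually.of_forall fun n => ?_
        by_contra hne
        have := (hφs n j _ (Ne.symm hne)).1
        linarith [hepos n j]
  exact tendsto_nhds_unique (lim1.congr key) lim2

end Product

/-! ### Integral representation of functions in the Sobolev space -/

/-- Möbius inversion on the subset lattice: for fixed `v`, the sum of `(-1)^|u|` over `u ⊇ v`
factors over the coordinates, and every `j ∉ v` contributes the factor `-1 + 1 = 0`. -/
theorem sum_neg_one_pow_sum_powerset {ι : Type*} [Fintype ι] [DecidableEq ι] (H : Finset ι → ℝ) :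
    ∑ u : Finset ι, (-1) ^ u.card * ∑ v ∈ u.powerset, (-1) ^ v.card * H v = H Finset.univ := by
  have h1 : ∀ v : Finset ι, ∑ u : Finset ι, (if v ⊆ u then (-1 : ℝ) ^ u.card else 0) =
      if v = Finset.univ then (-1 : ℝ) ^ v.card else 0 := by
    intro v
    have h2 : ∀ u : Finset ι, (if v ⊆ u then (-1 : ℝ) ^ u.card else 0) =
        (∏ _j ∈ u, (-1 : ℝ)) * ∏ j ∈ uᶜ, (if j ∈ v then (0 : ℝ) else 1) := by
      intro u
      rw [Finset.prod_const]
      split_ifs with h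
      · rw [Finset.prod_eq_one, mul_one]
        exact fun j hj => if_neg fun hv => Finset.mem_compl.1 hj (h hv)
      · obtain ⟨j, hjv, hju⟩ := Finset.not_subset.1 h
        have h0 : ∏ j ∈ uᶜ, (if j ∈ v then (0 : ℝ) else 1) = 0 :=
          Finset.prod_eq_zero (Finset.mem_compl.2 hju) (if_pos hjv)
        rw [h0, mul_zero]
    simp_rw [h2]
    rw [← Fintype.prod_add]
    split_ifs with h
    · simp [h]
    · obtain ⟨j, hj⟩ : ∃ j, j ∉ v := by
        by_contra hc; push Not at hc; exact h (Finset.eq_univ_iff_forall.2 hc)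
      exact Finset.prod_eq_zero (Finset.mem_univ j) (by simp [hj])
  have h3 : ∀ u : Finset ι, (-1) ^ u.card * ∑ v ∈ u.powerset, (-1) ^ v.card * H v =
      ∑ v : Finset ι, (if v ⊆ u then (-1 : ℝ) ^ u.card else 0) * ((-1) ^ v.card * H v) := by
    intro u
    have : u.powerset = Finset.univ.filter (· ⊆ u) := by ext; simp
    rw [this, Finset.sum_filter, Finset.mul_sum]
    refine Finset.sum_congr rfl fun v _ => ?_
    split_ifs <;> simp
  simp_rw [h3]
  rw [Finset.sum_comm]
  simp_rw [← Finset.sum_mul, h1]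
  rw [Finset.sum_eq_single Finset.univ]
  · simp only [if_true, ← mul_assoc, ← pow_add, ← two_mul]; simp
  · intro v _ hv; simp [hv]
  · simp

theorem continuousOn_anchoredSection {s : ℕ} {f : (Fin s → ℝ) → ℝ}
    (hf : ContinuousOn f (Set.Icc 0 1)) (u : Finset (Fin s)) :
    ContinuousOn (anchoredSection u f) (Set.Icc 0 1) := by
  refine hf.comp (Continuous.continuousOn (continuous_pi fun j => ?_)) ?_
  · by_cases h : j ∈ u
    · simpa [h] using continuous_apply _
    · simpa [h] using continuous_const
  · intro x hx
    constructor <;> intro j <;> by_cases h : j ∈ u <;> simp only [h, dite_true, dite_false]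
    · exact hx.1 _
    · simp
    · exact hx.2 _
    · simp

theorem IsAnchoredDeriv.memLp {s : ℕ} {f : (Fin s → ℝ) → ℝ} {u : Finset (Fin s)}
    {g : (u → ℝ) → ℝ} (h : IsAnchoredDeriv f u g) :
    MemLp g 2 (Measure.pi fun _ => unitMeas) := by
  have := h.1
  rwa [restrict_Icc_eq_pi] at this

theorem IsAnchoredDeriv.integrable {s : ℕ} {f : (Fin s → ℝ) → ℝ} {u : Finset (Fin s)}
    {g : (u → ℝ) → ℝ} (h : IsAnchoredDeriv f u g) :
    Integrable g (Measure.pi fun _ => unitMeas) :=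
  h.memLp.integrable one_le_two

/-- Each integral is the mixed difference of the section of `f` over `[y_u, 1]`, that is, an
alternating sum of the values `f(y_v, 1)` with `v ⊆ u`; inversion recovers `f y`. -/
theorem eq_sum_integral_anchoredDeriv {s : ℕ} {f : (Fin s → ℝ) → ℝ}
    (hf : ContinuousOn f (Set.Icc 0 1)) {G : ∀ u : Finset (Fin s), (u → ℝ) → ℝ}
    (hG : ∀ u, IsAnchoredDeriv f u (G u)) {y : Fin s → ℝ} (hy : ∀ j, y j ∈ Set.Ico (0 : ℝ) 1) :
    f y = ∑ u : Finset (Fin s), (-1) ^ u.card *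
      ∫ x, G u x * ∏ j : u, (if y j < x j then 1 else 0) ∂(Measure.pi fun _ => unitMeas) := by
  have h1 := sum_neg_one_pow_sum_powerset
    (fun v : Finset (Fin s) => f fun j => if j ∈ v then y j else 1)
  simp only [Finset.mem_univ, if_true] at h1
  rw [← h1]
  refine Finset.sum_congr rfl fun u _ => ?_
  congr 1
  rw [← sum_corners_eq_integral (continuousOn_anchoredSection hf u) (hG u).integrable (hG u).2
    (y := fun j : u => y j) fun j => hy j]
  symm
  refine Finset.sum_nbij' (fun v => v.map (Function.Embedding.subtype _))
    (fun w => w.subtype (· ∈ u)) ?_ ?_ ?_ ?_ ?_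
  · intro v _
    rw [Finset.mem_powerset]
    intro j hj
    obtain ⟨a, _, rfl⟩ := Finset.mem_map.1 hj
    exact a.2
  · simp
  · intro v _; ext; simp
  · intro w hw
    rw [Finset.mem_powerset] at hw
    ext j; simpa using fun h => hw h
  · intro v _
    rw [Finset.card_map]
    congr 1
    unfold anchoredSection
    congr 1
    funext j
    by_cases h : j ∈ u <;> simp [h]

/-! ### Integrals of products of one-dimensional functions -/

theorem prod_coe_eq_prod_univ {s : ℕ} (u : Finset (Fin s)) (h : u → ℝ → ℝ) (y : Fin s → ℝ) :
    ∏ j : u, h j (y j) = ∏ j, (if hj : j ∈ u then h ⟨j, hj⟩ else 1) (y j) := by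
  rw [← Finset.prod_subset (Finset.subset_univ u) (fun j _ hj => by simp [hj]),
    ← Finset.prod_coe_sort u]
  exact Finset.prod_congr rfl fun j _ => by simp

theorem integral_prod_coe {s : ℕ} (u : Finset (Fin s)) (h : u → ℝ → ℝ) :
    ∫ y : Fin s → ℝ, ∏ j : u, h j (y j) ∂(Measure.pi fun _ => unitMeas) =
      ∏ j : u, ∫ t, h j t ∂unitMeas := by
  simp_rw [prod_coe_eq_prod_univ]
  rw [integral_fintype_prod_eq_prod, ← Finset.prod_subset (Finset.subset_univ u)
    (fun j _ hj => by simp [hj]), ← Finset.prod_coe_sort u]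
  exact Finset.prod_congr rfl fun j _ => by simp

theorem measurable_step : Measurable fun z : ℝ × ℝ => (if z.1 < z.2 then (1 : ℝ) else 0) :=
  Measurable.ite (measurableSet_lt measurable_fst measurable_snd) measurable_const measurable_const

theorem integral_step_left {x : ℝ} (hx : x ∈ Set.Ioo (0 : ℝ) 1) :
    ∫ y, (if y < x then 1 else 0) ∂unitMeas = x := by
  have : (fun y : ℝ => if y < x then (1 : ℝ) else 0) = (Set.Iio x).indicator 1 := by
    funext y; simp [Set.indicator]
  rw [this, integral_indicator_one measurableSet_Iio, unitMeas, measureReal_restrict_apply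
    measurableSet_Iio, Set.inter_comm, Set.Ioo_inter_Iio, min_eq_right hx.2.le]
  simp [hx.1.le]

theorem integral_step_mul (y : ℝ) (hy : y ∈ Set.Ico (0 : ℝ) 1) (g : ℝ → ℝ) :
    ∫ x, g x * (if y < x then 1 else 0) ∂unitMeas = ∫ x in y..1, g x := by
  have : (fun x : ℝ => g x * if y < x then (1 : ℝ) else 0) = (Set.Ioi y).indicator g := by
    funext x; simp [Set.indicator]
  rw [this, integral_indicator measurableSet_Ioi, unitMeas,
    Measure.restrict_restrict measurableSet_Ioi, Set.inter_comm, Set.Ioo_inter_Ioi,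
    max_eq_right hy.1, intervalIntegral.integral_of_le hy.2.le, integral_Ioc_eq_integral_Ioo]

theorem integral_id_mul_step {y : ℝ} (hy : y ∈ Set.Ico (0 : ℝ) 1) :
    ∫ x, x * (if y < x then 1 else 0) ∂unitMeas = (1 - y ^ 2) / 2 := by
  rw [integral_step_mul y hy]; simp

theorem integral_step_mul_step {y z : ℝ} (hy : y ∈ Set.Ico (0 : ℝ) 1)
    (hz : z ∈ Set.Ico (0 : ℝ) 1) :
    ∫ x, (if y < x then 1 else 0) * (if z < x then 1 else 0) ∂unitMeas = 1 - max y z := by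
  have : ∀ x : ℝ, ((if y < x then 1 else 0) * (if z < x then 1 else 0) : ℝ) =
      1 * (if max y z < x then 1 else 0) := by
    intro x; by_cases h1 : y < x <;> by_cases h2 : z < x <;> simp [h1, h2]
  simp_rw [this]
  rw [integral_step_mul _ ⟨le_max_of_le_left hy.1, max_lt hy.2 hz.2⟩]; simp

theorem integral_id_mul_id : ∫ x, x * x ∂unitMeas = 1 / 3 := by
  simp_rw [← pow_two]
  rw [integral_unitMeas, integral_pow]; norm_num

/-! ### The integration error -/

theorem abs_prod_step_le_one {ι : Type*} [Fintype ι] (y x : ι → ℝ) :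
    |∏ j, (if y j < x j then (1 : ℝ) else 0)| ≤ 1 := by
  rw [Finset.abs_prod]
  refine Finset.prod_le_one (fun _ _ => abs_nonneg _) fun j _ => ?_
  split_ifs <;> simp

theorem measurable_prod_step {ι : Type*} [Fintype ι] (y : ι → ℝ) :
    Measurable fun x : ι → ℝ => ∏ j, (if y j < x j then (1 : ℝ) else 0) :=
  Finset.measurable_fun_prod _ fun j _ =>
    measurable_step.comp (measurable_const.prodMk (measurable_pi_apply j))

theorem abs_prod_le_one {ι : Type*} [Fintype ι] {x : ι → ℝ} (hx : ∀ j, x j ∈ Set.Ioo (0 : ℝ) 1) :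
    |∏ j, x j| ≤ 1 := by
  rw [Finset.abs_prod]
  exact Finset.prod_le_one (fun _ _ => abs_nonneg _) fun j _ => by
    rw [abs_of_pos (hx j).1]; exact (hx j).2.le

/-- Integrate the pointwise representation over `y` and apply Fubini; each step function `1[y_j <
x_j]` integrates to `x_j`. -/
theorem integral_eq_sum_integral_anchoredDeriv {s : ℕ} {f : (Fin s → ℝ) → ℝ}
    (hf : ContinuousOn f (Set.Icc 0 1)) {G : ∀ u : Finset (Fin s), (u → ℝ) → ℝ}
    (hG : ∀ u, IsAnchoredDeriv f u (G u)) :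
    ∫ x in Set.Icc (0 : Fin s → ℝ) 1, f x = ∑ u : Finset (Fin s), (-1) ^ u.card *
      ∫ x, G u x * ∏ j : u, x j ∂(Measure.pi fun _ => unitMeas) := by
  have hint : ∀ u : Finset (Fin s), Integrable (Function.uncurry fun (y : Fin s → ℝ) (x : u → ℝ) =>
      G u x * ∏ j : u, (if y j < x j then (1 : ℝ) else 0))
      ((Measure.pi fun _ => unitMeas).prod (Measure.pi fun _ => unitMeas)) := by
    intro u
    refine ((hG u).integrable.comp_snd _).mul_bdd (c := 1) ?_ ?_
    · refine Measurable.aestronglyMeasurable (Finset.measurable_fun_prod _ fun j _ => ?_)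
      exact measurable_step.comp (f := fun z : (Fin s → ℝ) × (u → ℝ) => (z.1 j, z.2 j))
        (by fun_prop)
    · exact Eventually.of_forall fun z => abs_prod_step_le_one _ _
  rw [restrict_Icc_eq_pi]
  have h1 : (fun y => f y) =ᵐ[Measure.pi fun _ => unitMeas] fun y =>
      ∑ u : Finset (Fin s), (-1) ^ u.card *
      ∫ x, G u x * ∏ j : u, (if y j < x j then 1 else 0) ∂(Measure.pi fun _ => unitMeas) := by
    filter_upwards [ae_pi_unitMeas] with y hy
    exact eq_sum_integral_anchoredDeriv hf hG fun j => ⟨(hy j).1.le, (hy j).2⟩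
  rw [integral_congr_ae h1, integral_finsetSum]
  · refine Finset.sum_congr rfl fun u _ => ?_
    rw [integral_const_mul, integral_integral_swap (hint u)]
    congr 1
    refine integral_congr_ae ?_
    filter_upwards [ae_pi_unitMeas] with x hx
    rw [integral_const_mul, integral_prod_coe u fun j t => if t < x j then 1 else 0]
    congr 1
    exact Finset.prod_congr rfl fun j _ => integral_step_left (hx j)
  · exact fun u _ => ((hint u).integral_prod_left).const_mul _

/-- The local discrepancy of the projection of the points to the coordinates in `u`. -/
noncomputable def localDisc {s : ℕ} (u : Finset (Fin s)) (S : ℕ → Fin s → ℝ) (N : ℕ)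
    (x : u → ℝ) : ℝ :=
  ∏ j, x j - 1 / (N : ℝ) * ∑ n ∈ Finset.range N, ∏ j : u, (if S n j < x j then 1 else 0)

theorem memLp_localDisc {s : ℕ} (u : Finset (Fin s)) (S : ℕ → Fin s → ℝ) (N : ℕ) :
    MemLp (localDisc u S N) 2 (Measure.pi fun _ => unitMeas) := by
  have h1 : MemLp (fun x : u → ℝ => ∏ j, x j) 2 (Measure.pi fun _ => unitMeas) := by
    refine MemLp.of_bound (Measurable.aestronglyMeasurable (by fun_prop)) 1 ?_
    filter_upwards [ae_pi_unitMeas] with x hx using abs_prod_le_one hx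
  have h2 : ∀ n ∈ Finset.range N, MemLp
      (fun x : u → ℝ => ∏ j : u, (if S n j < x j then (1 : ℝ) else 0)) 2
      (Measure.pi fun _ => unitMeas) := fun n _ =>
    MemLp.of_bound (measurable_prod_step _).aestronglyMeasurable 1
      (Eventually.of_forall fun x => abs_prod_step_le_one _ _)
  exact h1.sub ((memLp_finsetSum _ h2).const_mul (1 / (N : ℝ)))

theorem error_eq_sum_integral {s : ℕ} {f : (Fin s → ℝ) → ℝ}
    (hf : ContinuousOn f (Set.Icc 0 1)) {G : ∀ u : Finset (Fin s), (u → ℝ) → ℝ}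
    (hG : ∀ u, IsAnchoredDeriv f u (G u)) {S : ℕ → Fin s → ℝ}
    (hS : ∀ n j, S n j ∈ Set.Ico (0 : ℝ) 1) (N : ℕ) :
    (∫ x in Set.Icc (0 : Fin s → ℝ) 1, f x) - (1 / (N : ℝ)) * ∑ n ∈ Finset.range N, f (S n) =
      ∑ u : Finset (Fin s), (-1) ^ u.card *
        ∫ x, G u x * localDisc u S N x ∂(Measure.pi fun _ => unitMeas) := by
  rw [integral_eq_sum_integral_anchoredDeriv hf hG,
    Finset.sum_congr rfl fun n _ => eq_sum_integral_anchoredDeriv hf hG (hS n), Finset.sum_comm,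
    Finset.mul_sum, ← Finset.sum_sub_distrib]
  refine Finset.sum_congr rfl fun u _ => ?_
  rw [← Finset.mul_sum, mul_left_comm, ← mul_sub]
  congr 1
  have h1 : Integrable (fun x => G u x * ∏ j : u, x j) (Measure.pi fun _ => unitMeas) := by
    refine (hG u).integrable.mul_bdd (c := 1) (Measurable.aestronglyMeasurable (by fun_prop)) ?_
    filter_upwards [ae_pi_unitMeas] with x hx using abs_prod_le_one hx
  have h2 : ∀ n ∈ Finset.range N, Integrable
      (fun x : u → ℝ => G u x * ∏ j : u, (if S n j < x j then (1 : ℝ) else 0))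
      (Measure.pi fun _ => unitMeas) := by
    intro n _
    exact (hG u).integrable.mul_bdd (c := 1) (measurable_prod_step _).aestronglyMeasurable
      (Eventually.of_forall fun x => abs_prod_step_le_one _ _)
  rw [← integral_finsetSum _ h2, ← integral_const_mul, ← integral_sub h1
    ((integrable_finsetSum _ h2).const_mul _)]
  congr 1
  funext x
  rw [localDisc, ← Finset.mul_sum]
  ring

/-- The discriminant form of Cauchy-Schwarz. It lets the weighted sum over `u` and the integrals be
handled together, termwise for each `t`. -/
theorem sq_le_of_forall_two_mul_le {a B : ℝ} (h : ∀ t : ℝ, 2 * t * a ≤ 1 + t ^ 2 * B) :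
    a ^ 2 ≤ B := by
  by_contra hc
  push Not at hc
  have ha : 0 < a ^ 2 := by
    by_contra h0
    have h1 : a = 0 := by nlinarith [sq_nonneg a]
    subst h1
    have hB : B < 0 := by simpa using hc
    -- Here `a = 0` and `B < 0`; this value of `t` makes `1 + t² B = 1/B - 1 + B` negative.
    have := h (1 / B + (-1))
    have hB0 : B ≠ 0 := hB.ne
    have h2 : (1 / B + -1) ^ 2 * B = 1 / B - 2 + B := by field_simp; ring
    rw [h2] at this
    have : 1 / B < 0 := one_div_neg.2 hB
    linarith
  have h1 := h (1 / a)
  have hane : a ≠ 0 := fun h0 => by simp [h0] at ha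
  have h2 : 2 * (1 / a) * a = 2 := by field_simp
  have h3 : (1 / a) ^ 2 * B < 1 := by
    rw [div_pow, one_pow, div_mul_eq_mul_div, one_mul, div_lt_one ha]; exact hc
  linarith

/-- Cauchy-Schwarz for the pairing of derivatives with local discrepancies, the weights `γ_u⁻¹` of
the norm being dual to the weights `γ_u` here. -/
theorem worstCaseError_sq_le {s : ℕ} {γ : Fin s → ℝ} (hγ : ∀ j, 0 < γ j) {S : ℕ → Fin s → ℝ}
    (hS : ∀ n j, S n j ∈ Set.Ico (0 : ℝ) 1) (N : ℕ) :
    worstCaseError γ S N ^ 2 ≤ ENNReal.ofReal (∑ u : Finset (Fin s), (∏ j ∈ u, γ j) *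
      ∫ x, localDisc u S N x ^ 2 ∂(Measure.pi fun _ => unitMeas)) := by
  set B := ∑ u : Finset (Fin s), (∏ j ∈ u, γ j) *
      ∫ x, localDisc u S N x ^ 2 ∂(Measure.pi fun _ => unitMeas) with hB
  have hγu : ∀ u : Finset (Fin s), 0 < ∏ j ∈ u, γ j := fun u => Finset.prod_pos fun j _ => hγ j
  have hB0 : 0 ≤ B := Finset.sum_nonneg fun u _ =>
    mul_nonneg (hγu u).le (integral_nonneg fun x => sq_nonneg _)
  suffices h : worstCaseError γ S N ≤ ENNReal.ofReal √B by
    calc worstCaseError γ S N ^ 2 ≤ ENNReal.ofReal √B ^ 2 := by gcongr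
      _ = ENNReal.ofReal B := by
        rw [← ENNReal.ofReal_pow (Real.sqrt_nonneg _), Real.sq_sqrt hB0]
  refine iSup₂_le fun f hf => ENNReal.ofReal_le_ofReal ?_
  obtain ⟨⟨hfc, hfd⟩, hnorm⟩ := hf
  have hG : ∀ u, IsAnchoredDeriv f u (anchoredDeriv f u) := by
    intro u
    rw [anchoredDeriv, dif_pos (hfd u)]
    exact (hfd u).choose_spec
  rw [error_eq_sum_integral hfc hG hS]
  refine Real.abs_le_sqrt (sq_le_of_forall_two_mul_le fun t => ?_)
  have hA : ∑ u : Finset (Fin s), (∏ j ∈ u, γ j)⁻¹ *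
      ∫ x, anchoredDeriv f u x ^ 2 ∂(Measure.pi fun _ => unitMeas) ≤ 1 := by
    rw [sobolevNorm, Real.sqrt_le_one, sobolevInner] at hnorm
    simp_rw [restrict_Icc_eq_pi, ← pow_two] at hnorm
    exact hnorm
  refine le_trans ?_ (add_le_add_left hA _)
  rw [hB, Finset.mul_sum, Finset.mul_sum, ← Finset.sum_add_distrib]
  refine Finset.sum_le_sum fun u _ => ?_
  have i1 := (hG u).memLp.integrable_sq
  have i2 := (memLp_localDisc u S N).integrable_sq
  have i3 := (hG u).memLp.integrable_mul (memLp_localDisc u S N)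
  calc 2 * t * ((-1) ^ u.card *
        ∫ x, anchoredDeriv f u x * localDisc u S N x ∂(Measure.pi fun _ => unitMeas))
      = ∫ x, (2 * t * (-1) ^ u.card) * (anchoredDeriv f u x * localDisc u S N x)
          ∂(Measure.pi fun _ => unitMeas) := by rw [integral_const_mul]; ring
    _ ≤ ∫ x, ((∏ j ∈ u, γ j)⁻¹ * anchoredDeriv f u x ^ 2 +
          (t ^ 2 * ∏ j ∈ u, γ j) * localDisc u S N x ^ 2) ∂(Measure.pi fun _ => unitMeas) := by
        refine integral_mono (i3.const_mul _) ((i1.const_mul _).add (i2.const_mul _)) fun x => ?_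
        simp only
        set a := anchoredDeriv f u x
        set b := localDisc u S N x
        set c := ∏ j ∈ u, γ j with hc
        have hcp : 0 < c := hγu u
        have he : ((-1 : ℝ) ^ u.card) ^ 2 = 1 := by rw [← pow_mul, mul_comm, pow_mul]; simp
        -- The square is completed with weight `c = γ_u`, so that `a²` carries the weight of the
        -- Sobolev norm and `b²` that of the discrepancy.
        have : 0 ≤ c⁻¹ * (a - c * t * (-1) ^ u.card * b) ^ 2 := by positivity
        have h2 : c⁻¹ * (a - c * t * (-1) ^ u.card * b) ^ 2 =
            c⁻¹ * a ^ 2 - 2 * t * (-1) ^ u.card * (a * b) * (c⁻¹ * c) +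
              c⁻¹ * c * (t ^ 2 * c * (((-1) ^ u.card) ^ 2) * b ^ 2) := by ring
        rw [h2, inv_mul_cancel₀ hcp.ne', he] at this
        linarith
    _ = _ := by
        rw [integral_add (i1.const_mul _) (i2.const_mul _), integral_const_mul,
          integral_const_mul]; ring

/-- Warnock's formula: every term of the expanded square is a product over the coordinates of `u`.
-/
theorem integral_localDisc_sq {s : ℕ} (u : Finset (Fin s)) {S : ℕ → Fin s → ℝ}
    (hS : ∀ n j, S n j ∈ Set.Ico (0 : ℝ) 1) (N : ℕ) :
    ∫ x, localDisc u S N x ^ 2 ∂(Measure.pi fun _ => unitMeas) =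
      (∏ _j ∈ u, (1 / 3 : ℝ)) -
        2 / N * ∑ n ∈ Finset.range N, ∏ j ∈ u, ((1 - S n j ^ 2) / 2) +
        1 / (N : ℝ) ^ 2 * ∑ n ∈ Finset.range N, ∑ m ∈ Finset.range N,
          ∏ j ∈ u, (1 - max (S n j) (S m j)) := by
  set μ : Measure (u → ℝ) := Measure.pi fun _ => unitMeas with hμ
  set w : ℕ → (u → ℝ) → ℝ := fun n x => ∏ j : u, (if S n j < x j then 1 else 0) with hw
  have hwL : ∀ n, MemLp (w n) 2 μ := fun n =>
    MemLp.of_bound (measurable_prod_step _).aestronglyMeasurable 1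
      (Eventually.of_forall fun x => abs_prod_step_le_one _ _)
  have hxL : MemLp (fun x : u → ℝ => ∏ j, x j) 2 μ := by
    refine MemLp.of_bound (Measurable.aestronglyMeasurable (by fun_prop)) 1 ?_
    filter_upwards [ae_pi_unitMeas] with x hx using abs_prod_le_one hx
  have h0 : ∀ x, localDisc u S N x ^ 2 = (∏ j, x j) * (∏ j, x j) -
      2 / N * ∑ n ∈ Finset.range N, (∏ j, x j) * w n x +
      1 / (N : ℝ) ^ 2 * ∑ n ∈ Finset.range N, ∑ m ∈ Finset.range N, w n x * w m x := by
    intro x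
    rw [← Finset.sum_mul_sum, ← Finset.mul_sum, localDisc]
    ring
  have i1 : ∫ x, (∏ j, x j) * (∏ j, x j) ∂μ = ∏ _j ∈ u, (1 / 3 : ℝ) := by
    simp_rw [← Finset.prod_mul_distrib]
    rw [hμ, integral_fintype_prod_eq_prod (f := fun _ t => t * t)]
    simp [integral_id_mul_id]
  have i2 : ∀ n, ∫ x, (∏ j, x j) * w n x ∂μ = ∏ j ∈ u, ((1 - S n j ^ 2) / 2) := by
    intro n
    simp_rw [hw, ← Finset.prod_mul_distrib]
    rw [hμ, integral_fintype_prod_eq_prod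
      (f := fun (j : u) t => t * if S n j < t then 1 else 0), ← Finset.prod_coe_sort u]
    exact Finset.prod_congr rfl fun j _ => integral_id_mul_step (hS n j)
  have i3 : ∀ n m, ∫ x, w n x * w m x ∂μ = ∏ j ∈ u, (1 - max (S n j) (S m j)) := by
    intro n m
    simp_rw [hw, ← Finset.prod_mul_distrib]
    rw [hμ, integral_fintype_prod_eq_prod
      (f := fun (j : u) t => (if S n j < t then 1 else 0) * if S m j < t then 1 else 0),
      ← Finset.prod_coe_sort u]
    exact Finset.prod_congr rfl fun j _ => integral_step_mul_step (hS n j) (hS m j)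
  have j1 : Integrable (fun x : u → ℝ => (∏ j, x j) * (∏ j, x j)) μ := hxL.integrable_mul hxL
  have j2 : ∀ n ∈ Finset.range N, Integrable (fun x : u → ℝ => (∏ j, x j) * w n x) μ :=
    fun n _ => hxL.integrable_mul (hwL n)
  have j3 : ∀ n ∈ Finset.range N, ∀ m ∈ Finset.range N, Integrable (fun x => w n x * w m x) μ :=
    fun n _ m _ => (hwL n).integrable_mul (hwL m)
  have j4 := (integrable_finsetSum _ j2).const_mul (2 / (N : ℝ))
  have j5 := (integrable_finsetSum _ fun n hn => integrable_finsetSum _ (j3 n hn)).const_mul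
    (1 / (N : ℝ) ^ 2)
  simp_rw [h0]
  have j6 : Integrable (fun x : u → ℝ => (∏ j, x j) * (∏ j, x j) -
      2 / (N : ℝ) * ∑ n ∈ Finset.range N, (∏ j, x j) * w n x) μ := j1.sub j4
  rw [integral_add j6 j5, integral_sub j1 j4, integral_const_mul, integral_const_mul,
    integral_finsetSum _ j2, integral_finsetSum _ fun n hn => integrable_finsetSum _ (j3 n hn), i1]
  congr 2
  · simp_rw [i2]
  · refine Finset.sum_congr rfl fun n hn => ?_
    rw [integral_finsetSum _ (j3 n hn)]
    simp_rw [i3]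

/-! ### Finite digit reversals -/

/-- The radical inverse in base `p` of the `L` lowest digits of `m`. -/
noncomputable def finInv (p L m : ℕ) : ℝ :=
  ∑ r ∈ Finset.range L, ((m / p ^ r % p : ℕ) : ℝ) / (p : ℝ) ^ (r + 1)

/-- The integer whose base `p` digits are the reversed `L` lowest digits of `m`. -/
def digitRev (p : ℕ) : ℕ → ℕ → ℕ
  | 0, _ => 0
  | L + 1, m => m % p * p ^ L + digitRev p L (m / p)

theorem finInv_succ (p L m : ℕ) :
    finInv p (L + 1) m = ((m % p : ℕ) : ℝ) / p + finInv p L (m / p) / p := by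
  rw [finInv, Finset.sum_range_succ', finInv, Finset.sum_div, add_comm]
  congr 1
  · simp
  · refine Finset.sum_congr rfl fun r _ => ?_
    rw [pow_succ' p r, ← Nat.div_div_eq_div_mul, div_div, ← pow_succ]

theorem finInv_eq_digitRev {p : ℕ} (hp : 0 < p) (L m : ℕ) :
    finInv p L m = (digitRev p L m : ℝ) / (p : ℝ) ^ L := by
  have hp' : (p : ℝ) ≠ 0 := by positivity
  induction L generalizing m with
  | zero => simp [finInv, digitRev]
  | succ L ih =>
    rw [finInv_succ, ih, digitRev]
    push_cast
    field_simp
    ring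

theorem finInv_nonneg (p L m : ℕ) : 0 ≤ finInv p L m :=
  Finset.sum_nonneg fun _ _ => by positivity

theorem digitRev_lt {p : ℕ} (hp : 0 < p) (L m : ℕ) : digitRev p L m < p ^ L := by
  induction L generalizing m with
  | zero => simp [digitRev]
  | succ L ih =>
    rw [digitRev, pow_succ]
    have h1 := ih (m / p)
    have h2 : m % p + 1 ≤ p := Nat.mod_lt _ hp
    nlinarith [Nat.mul_le_mul_right (p ^ L) h2]

theorem finInv_add_le_one {p : ℕ} (hp : 0 < p) (L m : ℕ) :
    finInv p L m + 1 / (p : ℝ) ^ L ≤ 1 := by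
  have h : (digitRev p L m : ℝ) + 1 ≤ (p : ℝ) ^ L := by exact_mod_cast digitRev_lt hp L m
  have hp' : (0 : ℝ) < (p : ℝ) ^ L := by positivity
  rw [finInv_eq_digitRev hp, ← add_div, div_le_one hp']
  exact h

theorem finInv_mod (p L m : ℕ) : finInv p L (m % p ^ L) = finInv p L m := by
  induction L generalizing m with
  | zero => simp [finInv]
  | succ L ih =>
    rw [finInv_succ, finInv_succ, pow_succ', Nat.mod_mul_right_mod,
      Nat.mod_mul_right_div_self, ih]

theorem finInv_periodic (p L : ℕ) :
    Function.Periodic (finInv p L) (p ^ L) := fun m => by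
  rw [← finInv_mod, Nat.add_mod_right, finInv_mod]

theorem sum_range_mul_eq {E : Type*} [AddCommMonoid E] (M p : ℕ) (h : ℕ → E) :
    ∑ i ∈ Finset.range (M * p), h i =
      ∑ i ∈ Finset.range M, ∑ c ∈ Finset.range p, h (c + p * i) := by
  induction M with
  | zero => simp
  | succ M ih =>
    rw [add_mul, one_mul, Finset.sum_range_add, ih, Finset.sum_range_succ]
    congr 1
    exact Finset.sum_congr rfl fun c _ => by rw [add_comm, mul_comm]

/-- Digit reversal permutes `{0, …, p^L - 1}`; in the induction the lowest digit of the index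
becomes the highest digit of the value. -/
theorem sum_digitRev {E : Type*} [AddCommMonoid E] {p : ℕ} (hp : 0 < p) (L : ℕ) (h : ℕ → E) :
    ∑ i ∈ Finset.range (p ^ L), h (digitRev p L i) = ∑ i ∈ Finset.range (p ^ L), h i := by
  induction L generalizing h with
  | zero => simp [digitRev]
  | succ L ih =>
    rw [pow_succ, sum_range_mul_eq]
    have h1 : ∀ i, ∑ c ∈ Finset.range p, h (digitRev p (L + 1) (c + p * i)) =
        ∑ c ∈ Finset.range p, h (c * p ^ L + digitRev p L i) := by
      intro i
      refine Finset.sum_congr rfl fun c hc => ?_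
      rw [Finset.mem_range] at hc
      rw [digitRev, Nat.add_mul_mod_self_left, Nat.mod_eq_of_lt hc, Nat.add_mul_div_left _ _ hp,
        Nat.div_eq_of_lt hc, zero_add]
    simp_rw [h1]
    rw [ih fun x => ∑ c ∈ Finset.range p, h (c * p ^ L + x), Finset.sum_comm, mul_comm,
      sum_range_mul_eq]
    refine Finset.sum_congr rfl fun c _ => Finset.sum_congr rfl fun x _ => ?_
    rw [add_comm, mul_comm]

theorem sum_range_periodic_add {E : Type*} [AddCommMonoid E] {h : ℕ → E} {M : ℕ}
    (hh : Function.Periodic h M) (n : ℕ) :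
    ∑ a ∈ Finset.range M, h (n + a) = ∑ a ∈ Finset.range M, h a := by
  induction n with
  | zero => simp
  | succ n ih =>
    rw [← ih]
    cases M with
    | zero => simp
    | succ M =>
      rw [Finset.sum_range_succ, Finset.sum_range_succ' _ M]
      congr 1
      · exact Finset.sum_congr rfl fun a _ => by rw [add_assoc, add_comm 1 a]
      · rw [add_assoc, add_comm 1 M, hh, add_zero]

/-- As `a` runs through the residues modulo `p^L`, so does `n + a`, and the truncated radical
inverse meets each point of the grid of mesh `p^(-L)` once. -/
theorem sum_comp_finInv {p : ℕ} (hp : 0 < p) (L n : ℕ) (h : ℝ → ℝ) :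
    ∑ a ∈ Finset.range (p ^ L), h (finInv p L (n + a)) =
      ∑ i ∈ Finset.range (p ^ L), h (i / (p : ℝ) ^ L) := by
  have h1 := sum_range_periodic_add (h := fun m => h (finInv p L m)) (M := p ^ L)
    ((finInv_periodic p L).comp h) n
  rw [h1, ← sum_digitRev hp L fun i => h (i / (p : ℝ) ^ L)]
  simp_rw [finInv_eq_digitRev hp]

/-! ### The radical inverse function -/

theorem radicalInverse_eq_finInv {p n L : ℕ} (hp : 0 < p) (h : n < p ^ L) :
    radicalInverse p n = finInv p L n := by
  refine tsum_eq_sum fun r hr => ?_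
  rw [Finset.mem_range, not_lt] at hr
  rw [Nat.div_eq_of_lt (h.trans_le (Nat.pow_le_pow_right hp hr))]
  simp

theorem radicalInverse_nonneg (p n : ℕ) : 0 ≤ radicalInverse p n :=
  tsum_nonneg fun _ => by positivity

theorem radicalInverse_lt_one {p : ℕ} (hp : 1 < p) (n : ℕ) : radicalInverse p n < 1 := by
  rw [radicalInverse_eq_finInv (by omega) (Nat.lt_pow_self hp)]
  have := finInv_add_le_one (zero_lt_one.trans hp) n n
  have : 0 < 1 / (p : ℝ) ^ n := by positivity
  linarith

theorem radicalInverse_rec {p : ℕ} (hp : 1 < p) (n : ℕ) :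
    radicalInverse p n * p = (n % p : ℕ) + radicalInverse p (n / p) := by
  have h1 : n < p ^ (n + 1) := (Nat.lt_pow_self hp).trans (Nat.pow_lt_pow_right hp n.lt_succ_self)
  have h2 : n / p < p ^ n := (Nat.div_le_self n p).trans_lt (Nat.lt_pow_self hp)
  have hp' : (p : ℝ) ≠ 0 := by positivity
  rw [radicalInverse_eq_finInv (by omega) h1, radicalInverse_eq_finInv (by omega) h2, finInv_succ]
  field_simp

theorem realDigit_radicalInverse {p : ℕ} (hp : 1 < p) (n r : ℕ) :
    realDigit p (radicalInverse p n) r = n / p ^ r % p := by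
  induction r generalizing n with
  | zero =>
    have h0 := radicalInverse_nonneg p (n / p)
    have h1 := radicalInverse_lt_one hp (n / p)
    rw [realDigit, zero_add, pow_one, radicalInverse_rec hp, add_comm, Nat.floor_add_natCast h0,
      Nat.floor_eq_zero.2 h1]
    simp
  | succ r ih =>
    have h0 := radicalInverse_nonneg p (n / p)
    have h2 : radicalInverse p n * (p : ℝ) ^ (r + 1 + 1) =
        ((n % p * p ^ (r + 1) : ℕ) : ℝ) + radicalInverse p (n / p) * (p : ℝ) ^ (r + 1) := by
      rw [pow_succ' (p : ℝ) (r + 1), ← mul_assoc, radicalInverse_rec hp]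
      push_cast; ring
    have h3 : n / p ^ (r + 1) = n / p / p ^ r := by rw [pow_succ', ← Nat.div_div_eq_div_mul]
    rw [h3, ← ih, realDigit, h2, add_comm, Nat.floor_add_natCast (by positivity), add_comm,
      pow_succ p r, ← mul_assoc,
      Nat.add_mod, Nat.mul_mod_left, zero_add, Nat.mod_mod]
    rfl

/-! ### Digits of `p`-adic integers -/

section Padic

variable {p : ℕ} [hpf : Fact p.Prime]

theorem appr_eq_mod {z : ℤ_[p]} {m k : ℕ} (h : z - m ∈ Ideal.span {(p : ℤ_[p]) ^ k}) :
    z.appr k = m % p ^ k := by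
  have h1 : ((((m : ℤ) - (z.appr k : ℤ) : ℤ)) : ℤ_[p]) ∈ Ideal.span {(p : ℤ_[p]) ^ k} := by
    have := Ideal.sub_mem _ (PadicInt.appr_spec k z) h
    push_cast
    convert! this using 1
    ring
  rw [← PadicInt.norm_le_pow_iff_mem_span_pow, PadicInt.norm_int_le_pow_iff_dvd] at h1
  have h2 : z.appr k ≡ m [MOD p ^ k] := by
    rw [Nat.modEq_iff_dvd]; exact_mod_cast h1
  rw [← Nat.mod_eq_of_lt (PadicInt.appr_lt z k)]
  exact h2

theorem padicDigit_eq {z w : ℤ_[p]} {m L : ℕ} (h : z = m + (p : ℤ_[p]) ^ L * w) {r : ℕ}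
    (hr : r < L) : padicDigit z r = m / p ^ r % p := by
  have h1 : z.appr (r + 1) = m % p ^ (r + 1) := by
    refine appr_eq_mod (Ideal.mem_span_singleton.2 ?_)
    rw [h, add_sub_cancel_left]
    exact (pow_dvd_pow _ hr).mul_right _
  rw [padicDigit, h1, pow_succ, Nat.mod_mul_right_div_self]

theorem padicDigit_lt (z : ℤ_[p]) (r : ℕ) : padicDigit z r < p := by
  rw [padicDigit, Nat.div_lt_iff_lt_mul (pow_pos hpf.out.pos r), ← pow_succ']
  exact PadicInt.appr_lt z (r + 1)

theorem summable_digits (d : ℕ → ℕ) : Summable fun r => (d r : ℤ_[p]) * (p : ℤ_[p]) ^ r := by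
  have hp1 : (1 : ℝ) < p := by exact_mod_cast hpf.out.one_lt
  refine Summable.of_norm_bounded (g := fun r : ℕ => ((p : ℝ)⁻¹) ^ r)
    (summable_geometric_of_lt_one (by positivity) (inv_lt_one_of_one_lt₀ hp1)) fun r => ?_
  rw [norm_mul, norm_pow, PadicInt.norm_p]
  exact mul_le_of_le_one_left (by positivity) (PadicInt.norm_le_one _)

/-- This identifies the shift of a Halton coordinate with addition of a `p`-adic integer to the
index `n`. -/
theorem monnaInv_radicalInverse (n : ℕ) : monnaInv p (radicalInverse p n) = n := by
  have hp := hpf.out.one_lt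
  rw [monnaInv]
  simp_rw [realDigit_radicalInverse hp]
  rw [tsum_eq_sum (s := Finset.range n)]
  · have h1 : ∀ L, ∑ r ∈ Finset.range L, n / p ^ r % p * p ^ r = n % p ^ L := by
      intro L
      induction L with
      | zero => simp [Nat.mod_one]
      | succ L ih => rw [Finset.sum_range_succ, ih, Nat.mod_pow_succ, mul_comm (p ^ L)]
    have h2 := h1 n
    rw [Nat.mod_eq_of_lt (Nat.lt_pow_self hp)] at h2
    exact_mod_cast congrArg (Nat.cast : ℕ → ℤ_[p]) h2
  · intro r hr
    rw [Finset.mem_range, not_lt] at hr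
    rw [Nat.div_eq_of_lt ((Nat.lt_pow_self hp).trans_le (Nat.pow_le_pow_right hpf.out.pos hr))]
    simp

theorem sum_realDigit (x : ℝ) (L : ℕ) :
    ∑ r ∈ Finset.range L, realDigit p x r * p ^ r = digitRev p L ⌊x * (p : ℝ) ^ L⌋₊ := by
  have hp : (p : ℝ) ≠ 0 := by exact_mod_cast hpf.out.ne_zero
  induction L with
  | zero => simp [digitRev]
  | succ L ih =>
    have h1 : ⌊x * (p : ℝ) ^ (L + 1)⌋₊ / p = ⌊x * (p : ℝ) ^ L⌋₊ := by
      rw [← Nat.floor_div_natCast]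
      congr 1
      rw [pow_succ]; field_simp
    rw [Finset.sum_range_succ, ih, digitRev, h1, realDigit, add_comm]

theorem exists_monnaInv_eq (x : ℝ) (L : ℕ) :
    ∃ w : ℤ_[p], monnaInv p x = digitRev p L ⌊x * (p : ℝ) ^ L⌋₊ + (p : ℤ_[p]) ^ L * w := by
  refine ⟨∑' r, (realDigit p x (r + L) : ℤ_[p]) * (p : ℤ_[p]) ^ r, ?_⟩
  rw [monnaInv, ← (summable_digits _).sum_add_tsum_nat_add L, ← sum_realDigit,
    ← ((summable_digits _).tsum_mul_left _)]
  push_cast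
  congr 1
  exact tsum_congr fun r => by rw [pow_add]; ring

/-- The tail is dominated by the geometric series with all digits equal to `p - 1`, whose sum is
`p^(-L)`. -/
theorem tsum_digit_mem {d : ℕ → ℕ} (hd : ∀ r, d r < p) (L : ℕ) :
    ∑ r ∈ Finset.range L, (d r : ℝ) / (p : ℝ) ^ (r + 1) ≤ ∑' r, (d r : ℝ) / (p : ℝ) ^ (r + 1) ∧
    ∑' r, (d r : ℝ) / (p : ℝ) ^ (r + 1) ≤
      ∑ r ∈ Finset.range L, (d r : ℝ) / (p : ℝ) ^ (r + 1) + 1 / (p : ℝ) ^ L := by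
  have hp1 : (1 : ℝ) < p := by exact_mod_cast hpf.out.one_lt
  have hp0 : (p : ℝ) ≠ 0 := by positivity
  have hgeo : ∀ L : ℕ, HasSum (fun r : ℕ => ((p : ℝ) - 1) / (p : ℝ) ^ (r + L + 1))
      (1 / (p : ℝ) ^ L) := by
    intro L
    have h := (hasSum_geometric_of_lt_one (by positivity)
      (inv_lt_one_of_one_lt₀ hp1)).mul_left (((p : ℝ) - 1) / (p : ℝ) ^ (L + 1))
    have hp2 : (p : ℝ) - 1 ≠ 0 := by linarith
    have h2 : ((p : ℝ) - 1) / (p : ℝ) ^ (L + 1) * (1 - (p : ℝ)⁻¹)⁻¹ = 1 / (p : ℝ) ^ L := by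
      have : (1 - (p : ℝ)⁻¹) = (p - 1) / p := by field_simp
      rw [this, inv_div]; field_simp; ring
    rw [h2] at h
    have h4 : (fun r : ℕ => ((p : ℝ) - 1) / (p : ℝ) ^ (r + L + 1)) =
        fun r : ℕ => ((p : ℝ) - 1) / (p : ℝ) ^ (L + 1) * (p : ℝ)⁻¹ ^ r := by
      funext r
      rw [inv_pow, ← div_eq_mul_inv, div_div, ← pow_add]
      ring_nf
    rw [h4]; exact h
  have hle : ∀ r, (d r : ℝ) ≤ p - 1 := by
    intro r
    have : (d r : ℝ) + 1 ≤ p := by exact_mod_cast hd r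
    linarith
  have hsum : Summable fun r => (d r : ℝ) / (p : ℝ) ^ (r + 1) := by
    refine Summable.of_nonneg_of_le (fun r => by positivity) (fun r => ?_) (hgeo 0).summable
    exact div_le_div_of_nonneg_right (hle r) (by positivity)
  have hsumL : Summable fun r => (d (r + L) : ℝ) / (p : ℝ) ^ (r + L + 1) :=
    (summable_nat_add_iff L).2 hsum
  rw [← hsum.sum_add_tsum_nat_add L]
  constructor
  · exact le_add_of_nonneg_right (tsum_nonneg fun r => by positivity)
  · rw [← (hgeo L).tsum_eq]
    refine add_le_add_right (hsumL.tsum_le_tsum (fun r => ?_) (hgeo L).summable) _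
    exact div_le_div_of_nonneg_right (hle _) (by positivity)

/-! ### Shifted points in the cells of the shift -/

/-- The indicator of the residue classes whose digit reversal lies in the last interval of
length `p ^ (-L)`. -/
noncomputable def lastCell (p L m : ℕ) : ℝ := if 1 ≤ finInv p L m + 1 / (p : ℝ) ^ L then 1 else 0

theorem padicShift_mem_Ico (x σ : ℝ) : padicShift p x σ ∈ Set.Ico (0 : ℝ) 1 :=
  ⟨Int.fract_nonneg _, Int.fract_lt_one _⟩

/-- The sum `n + φ_p^+(σ)` is known modulo `p^L` from the first `L` digits of `σ`, which fixes `L`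
digits of the shifted point. The reduction modulo `1` matters only if all digits are `p - 1`, where
the value drops from `1` to `0`; `lastCell` gives away the whole unit on that cell. -/
theorem padicShift_radicalInverse_bounds (n L : ℕ) (σ : ℝ) :
    finInv p L (n + digitRev p L ⌊σ * (p : ℝ) ^ L⌋₊) -
        lastCell p L (n + digitRev p L ⌊σ * (p : ℝ) ^ L⌋₊) ≤
      padicShift p (radicalInverse p n) σ ∧
    padicShift p (radicalInverse p n) σ ≤
      finInv p L (n + digitRev p L ⌊σ * (p : ℝ) ^ L⌋₊) + 1 / (p : ℝ) ^ L := by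
  obtain ⟨w, hw⟩ := exists_monnaInv_eq (p := p) σ L
  set m := n + digitRev p L ⌊σ * (p : ℝ) ^ L⌋₊ with hm
  have hz : monnaInv p (radicalInverse p n) + monnaInv p σ = (m : ℤ_[p]) + (p : ℤ_[p]) ^ L * w := by
    rw [monnaInv_radicalInverse, hw, hm]; push_cast; ring
  rw [padicShift, monna]
  set z := monnaInv p (radicalInverse p n) + monnaInv p σ
  have h1 : ∑ r ∈ Finset.range L, (padicDigit z r : ℝ) / (p : ℝ) ^ (r + 1) = finInv p L m :=
    Finset.sum_congr rfl fun r hr => by rw [padicDigit_eq hz (Finset.mem_range.1 hr)]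
  obtain ⟨h2, h3⟩ := tsum_digit_mem (padicDigit_lt z) L
  rw [h1] at h2 h3
  set T := ∑' r, (padicDigit z r : ℝ) / (p : ℝ) ^ (r + 1)
  have hT : 0 ≤ T := (finInv_nonneg p L m).trans h2
  constructor
  · unfold lastCell
    split_ifs with h
    · have : 0 < 1 / (p : ℝ) ^ L := by have := hpf.out.pos; positivity
      linarith [finInv_add_le_one hpf.out.pos L m, Int.fract_nonneg T]
    · rw [Int.fract_eq_self.2 ⟨hT, by linarith⟩]; linarith
  · have : Int.fract T ≤ T := by
      have : (0 : ℝ) ≤ ⌊T⌋ := by exact_mod_cast Int.floor_nonneg.2 hT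
      rw [Int.fract]; linarith
    linarith

end Padic

/-! ### Averages over the cells -/

theorem integral_comp_floor {M : ℕ} (hM : 0 < M) (h : ℕ → ℝ) :
    ∫ t, h ⌊t * M⌋₊ ∂unitMeas = (∑ i ∈ Finset.range M, h i) / M := by
  have hM' : (0 : ℝ) < M := by exact_mod_cast hM
  have hpiece : ∀ i : ℕ, ∀ t ∈ Set.Ioo ((i : ℝ) / M) ((i + 1 : ℕ) / M), h ⌊t * M⌋₊ = h i := by
    intro i t ht
    congr 1
    rw [Set.mem_Ioo, div_lt_iff₀ hM', lt_div_iff₀ hM'] at ht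
    have hi : (0 : ℝ) ≤ i := i.cast_nonneg
    rw [Nat.floor_eq_iff (by linarith)]
    push_cast at ht
    exact ⟨ht.1.le, ht.2⟩
  have hle : ∀ i : ℕ, (i : ℝ) / M ≤ (i + 1 : ℕ) / M := fun i => by gcongr; simp
  have hii : ∀ i : ℕ, IntervalIntegrable (fun t => h ⌊t * M⌋₊) volume ((i : ℝ) / M)
      ((i + 1 : ℕ) / M) := by
    intro i
    rw [intervalIntegrable_iff_integrableOn_Ioo_of_le (hle i)]
    refine IntegrableOn.congr_fun (f := fun _ => h i) ?_ (fun t ht => (hpiece i t ht).symm)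
      measurableSet_Ioo
    exact integrableOn_const (by simp)
  have hval : ∀ i : ℕ, ∫ t in ((i : ℝ) / M)..((i + 1 : ℕ) / M), h ⌊t * M⌋₊ = h i / M := by
    intro i
    rw [intervalIntegral.integral_of_le (hle i), integral_Ioc_eq_integral_Ioo,
      setIntegral_congr_fun measurableSet_Ioo (hpiece i), setIntegral_const, measureReal_def,
      Real.volume_Ioo, ENNReal.toReal_ofReal (by linarith [hle i]), smul_eq_mul]
    push_cast; ring
  have hsum := intervalIntegral.sum_integral_adjacent_intervals (n := M)
    (a := fun i : ℕ => (i : ℝ) / M) fun i _ => hii i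
  rw [integral_unitMeas, Finset.sum_div]
  simp only [hval, Nat.cast_zero, zero_div, div_self hM'.ne'] at hsum
  exact hsum.symm

/-- The residue modulo `p^L` of the `p`-adic integer of a uniform shift is uniform. -/
theorem integral_comp_digitRev_floor {p : ℕ} (hp : 0 < p) (L : ℕ) (h : ℕ → ℝ) :
    ∫ t, h (digitRev p L ⌊t * (p : ℝ) ^ L⌋₊) ∂unitMeas =
      (∑ a ∈ Finset.range (p ^ L), h a) / (p : ℝ) ^ L := by
  have := integral_comp_floor (pow_pos hp L) fun i => h (digitRev p L i)
  rw [sum_digitRev hp L h] at this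
  exact_mod_cast this

/-! ### The mean distance of two shifted points -/

/-- The first martingale difference of the shift-averaged kernel, as a function of `k` modulo
`p`. -/
noncomputable def baseCoeff (p : ℕ) (k : ℤ) : ℝ :=
  1 / 6 - ((k % p : ℤ) : ℝ) * (p - (k % p : ℤ)) / (p : ℝ) ^ 2 -
    if (p : ℤ) ∣ k then 1 / (6 * (p : ℝ)) else 0

/-- The martingale difference of level `r` of the shift-averaged kernel. -/
noncomputable def levelCoeff (p r : ℕ) (k : ℤ) : ℝ :=
  if (p : ℤ) ^ r ∣ k then baseCoeff p (k / (p : ℤ) ^ r) / (p : ℝ) ^ r else 0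

/-- Half of the mean distance of the first `L` digits of two shifted points of difference `k`. -/
noncomputable def halfDist (p L : ℕ) (k : ℤ) : ℝ :=
  1 / 6 - ∑ r ∈ Finset.range L, levelCoeff p r k -
    if (p : ℤ) ^ L ∣ k then 1 / (6 * (p : ℝ) ^ L) else 0

theorem levelCoeff_zero (p : ℕ) (k : ℤ) : levelCoeff p 0 k = baseCoeff p k := by
  simp [levelCoeff]

theorem pow_succ_dvd_iff {p : ℕ} (hp : 0 < p) (r : ℕ) {k : ℤ} (h : (p : ℤ) ∣ k) :
    (p : ℤ) ^ (r + 1) ∣ k ↔ (p : ℤ) ^ r ∣ k / p := by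
  obtain ⟨l, rfl⟩ := h
  have hp' : (p : ℤ) ≠ 0 := by exact_mod_cast hp.ne'
  rw [pow_succ', mul_dvd_mul_iff_left hp', Int.mul_ediv_cancel_left _ hp']

theorem levelCoeff_succ {p : ℕ} (hp : 0 < p) (r : ℕ) (k : ℤ) :
    levelCoeff p (r + 1) k = if (p : ℤ) ∣ k then levelCoeff p r (k / p) / p else 0 := by
  unfold levelCoeff
  split_ifs with h1 h2 h3 h4 h5
  · rw [pow_succ' (p : ℤ), ← Int.ediv_ediv_of_nonneg (by positivity), pow_succ, div_div]
  · exact absurd ((pow_succ_dvd_iff hp r h2).1 h1) h3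
  · exact absurd ((dvd_pow_self _ (Nat.succ_ne_zero r)).trans h1) h2
  · exact absurd ((pow_succ_dvd_iff hp r h4).2 h5) h1
  · simp
  · rfl

theorem halfDist_succ_of_dvd {p : ℕ} (hp : 0 < p) (L : ℕ) {k : ℤ} (h : (p : ℤ) ∣ k) :
    halfDist p (L + 1) k = halfDist p L (k / p) / p := by
  have hp' : (p : ℝ) ≠ 0 := by positivity
  have h0 : levelCoeff p 0 k = 1 / 6 - 1 / (6 * (p : ℝ)) := by
    rw [levelCoeff_zero, baseCoeff, Int.emod_eq_zero_of_dvd h, if_pos h]; simp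
  have h1 : ∀ r, levelCoeff p (r + 1) k = levelCoeff p r (k / p) / p := fun r => by
    rw [levelCoeff_succ hp, if_pos h]
  unfold halfDist
  rw [Finset.sum_range_succ', h0]
  simp_rw [h1, pow_succ_dvd_iff hp L h]
  rw [← Finset.sum_div]
  split_ifs
  · field_simp; ring
  · field_simp; ring

theorem halfDist_succ_of_not_dvd {p : ℕ} (hp : 0 < p) (L : ℕ) {k : ℤ} (h : ¬ (p : ℤ) ∣ k) :
    halfDist p (L + 1) k = ((k % p : ℤ) : ℝ) * (p - (k % p : ℤ)) / (p : ℝ) ^ 2 := by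
  have h1 : ∀ r, levelCoeff p (r + 1) k = 0 := fun r => by rw [levelCoeff_succ hp, if_neg h]
  have h2 : ¬ (p : ℤ) ^ (L + 1) ∣ k := fun h3 => h ((dvd_pow_self _ (Nat.succ_ne_zero L)).trans h3)
  rw [halfDist, Finset.sum_range_succ', levelCoeff_zero, if_neg h2, baseCoeff, if_neg h]
  simp [h1]

theorem halfDist_zero_right {p : ℕ} (hp : 0 < p) (L : ℕ) : halfDist p L 0 = 0 := by
  induction L with
  | zero => simp [halfDist]
  | succ L ih => rw [halfDist_succ_of_dvd hp L (dvd_zero _)]; simp [ih]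

/-- A nonzero `k` below `p^g` in absolute value is divisible by no `p^r` with `r ≥ g`, so higher
levels vanish. Thus the truncation depth `L` can tend to infinity while the number of levels stays
`g`. -/
theorem halfDist_eq_of_le {p : ℕ} (hp : 0 < p) {g L : ℕ} (hg : g ≤ L) {k : ℤ}
    (hk : |k| < (p : ℤ) ^ g) : halfDist p L k = halfDist p g k := by
  rcases eq_or_ne k 0 with rfl | h0
  · rw [halfDist_zero_right hp, halfDist_zero_right hp]
  have h1 : ∀ r, g ≤ r → ¬ (p : ℤ) ^ r ∣ k := fun r hr h =>
    h0 (Int.eq_zero_of_abs_lt_dvd ((pow_dvd_pow _ hr).trans h) hk)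
  rw [halfDist, halfDist, if_neg (h1 L hg), if_neg (h1 g le_rfl)]
  congr 2
  refine (Finset.sum_subset (Finset.range_mono hg) fun r _ hr => ?_).symm
  rw [Finset.mem_range, not_lt] at hr
  rw [levelCoeff, if_neg (h1 r hr)]

/-- Rotation by `k` moves `p - k` residues up by `k`, and the other `k` wrap around and move down by
`p - k`. -/
theorem sum_abs_mod_sub_of_lt {p k : ℕ} (hk : k ≤ p) :
    ∑ c ∈ Finset.range p, |(((k + c) % p : ℕ) : ℝ) - (c : ℝ)| = 2 * (k * ((p : ℝ) - k)) := by
  obtain ⟨q, rfl⟩ := Nat.exists_eq_add_of_le' hk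
  rw [Finset.sum_range_add]
  have h1 : ∀ c ∈ Finset.range q, |(((k + c) % (q + k) : ℕ) : ℝ) - (c : ℝ)| = k := by
    intro c hc
    rw [Finset.mem_range] at hc
    rw [Nat.mod_eq_of_lt (by omega)]
    push_cast
    rw [add_sub_cancel_right, abs_of_nonneg (by positivity)]
  have h2 : ∀ c ∈ Finset.range k,
      |(((k + (q + c)) % (q + k) : ℕ) : ℝ) - ((q + c : ℕ) : ℝ)| = q := by
    intro c hc
    rw [Finset.mem_range] at hc
    rw [show k + (q + c) = c + (q + k) by ring, Nat.add_mod_right, Nat.mod_eq_of_lt (by omega)]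
    push_cast
    rw [show (c : ℝ) - (q + c) = -q by ring, abs_neg, abs_of_nonneg (by positivity)]
  rw [Finset.sum_congr rfl h1, Finset.sum_congr rfl h2]
  simp only [Finset.sum_const, Finset.card_range, nsmul_eq_mul]
  push_cast; ring

theorem sum_abs_mod_sub_mod {p : ℕ} (hp : 0 < p) (n m : ℕ) :
    ∑ c ∈ Finset.range p, |(((n + c) % p : ℕ) : ℝ) - ((m + c) % p : ℕ)| =
      2 * (((((n : ℤ) - m) % p : ℤ) : ℝ) * (p - ((((n : ℤ) - m) % p : ℤ) : ℝ))) := by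
  have hper : Function.Periodic
      (fun c : ℕ => |(((n + c) % p : ℕ) : ℝ) - ((m + c) % p : ℕ)|) p := by
    intro c; simp only [← add_assoc, Nat.add_mod_right]
  -- Translating `c` by `t` makes `m` vanish modulo `p`, which reduces to the rotation of `{0, …, p
  -- - 1}`.
  obtain ⟨t, q, ht⟩ : ∃ t q, m + t = p * q := by
    refine ⟨p * m - m, m, ?_⟩
    have : m ≤ p * m := Nat.le_mul_of_pos_left m hp
    omega
  set k := (n + t) % p with hk
  have hkp : k < p := Nat.mod_lt _ hp
  have h1 : ((n : ℤ) - m) % p = k := by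
    have h2 : (n : ℤ) - m = ((n + t : ℕ) : ℤ) - p * q := by zify at ht; push_cast; linarith
    rw [h2, Int.sub_mul_emod_self_left, hk]; rfl
  rw [← sum_range_periodic_add hper t, h1]
  rw [Int.cast_natCast, ← sum_abs_mod_sub_of_lt hkp.le]
  refine Finset.sum_congr rfl fun c hc => ?_
  rw [Finset.mem_range] at hc
  rw [← add_assoc, ← add_assoc, ht, Nat.mul_add_mod, Nat.mod_eq_of_lt hc, hk, Nat.mod_add_mod]

/-- Split `a` into its lowest digit `c` and the rest. If `p ∣ n - m`, the leading digits of the two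
points agree for every `c` and the distance is `1/p` times that for `(n - m)/p`. Otherwise the
leading digits differ and fix the sign of the difference. -/
theorem sum_abs_finInv_sub {p : ℕ} (hp : 0 < p) (L n m : ℕ) :
    ∑ a ∈ Finset.range (p ^ L), |finInv p L (n + a) - finInv p L (m + a)| =
      2 * (p : ℝ) ^ L * halfDist p L ((n : ℤ) - m) := by
  have hp' : (0 : ℝ) < p := by exact_mod_cast hp
  induction L generalizing n m with
  | zero => simp [finInv, halfDist]
  | succ L ih =>
    have hrec : ∀ n a c, finInv p (L + 1) (n + (c + p * a)) =
        (((n + c) % p : ℕ) : ℝ) / p + finInv p L ((n + c) / p + a) / p := by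
      intro n a c
      rw [← add_assoc, finInv_succ, Nat.add_mul_mod_self_left, Nat.add_mul_div_left _ _ hp]
    rw [pow_succ, sum_range_mul_eq, Finset.sum_comm]
    simp_rw [hrec]
    by_cases h : (p : ℤ) ∣ (n : ℤ) - m
    · have h1 : ∀ c, (n + c) % p = (m + c) % p := by
        intro c
        have : m + c ≡ n + c [MOD p] := by
          rw [Nat.modEq_iff_dvd]; push_cast; simpa using h
        exact this.symm
      have h2 : ∀ c, (((n + c) / p : ℕ) : ℤ) - ((m + c) / p : ℕ) = ((n : ℤ) - m) / p := by
        intro c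
        have e1 := Nat.div_add_mod (n + c) p
        have e2 := Nat.div_add_mod (m + c) p
        rw [h1 c] at e1
        symm
        refine Int.ediv_eq_of_eq_mul_right (by exact_mod_cast hp.ne') ?_
        zify at e1 e2 ⊢
        linarith
      have h3 : ∀ c, ∑ a ∈ Finset.range (p ^ L),
          |(((n + c) % p : ℕ) : ℝ) / p + finInv p L ((n + c) / p + a) / p -
            ((((m + c) % p : ℕ) : ℝ) / p + finInv p L ((m + c) / p + a) / p)| =
          2 * (p : ℝ) ^ L * halfDist p L (((n : ℤ) - m) / p) / p := by
        intro c
        rw [← h2 c, ← ih, Finset.sum_div]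
        refine Finset.sum_congr rfl fun a _ => ?_
        rw [h1 c, add_sub_add_left_eq_sub, ← sub_div, abs_div, abs_of_pos hp']
      rw [Finset.sum_congr rfl fun c _ => h3 c, halfDist_succ_of_dvd hp L h, Finset.sum_const,
        Finset.card_range, nsmul_eq_mul]
      field_simp
      ring
    · have h3 : ∀ c, ∑ a ∈ Finset.range (p ^ L),
          |(((n + c) % p : ℕ) : ℝ) / p + finInv p L ((n + c) / p + a) / p -
            ((((m + c) % p : ℕ) : ℝ) / p + finInv p L ((m + c) / p + a) / p)| =
          (p : ℝ) ^ L * (|(((n + c) % p : ℕ) : ℝ) - ((m + c) % p : ℕ)| / p) := by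
        intro c
        have hne : (n + c) % p ≠ (m + c) % p := by
          intro he
          apply h
          have : m + c ≡ n + c [MOD p] := he.symm
          rw [Nat.modEq_iff_dvd] at this; push_cast at this; simpa using this
        have hbd : ∀ x, 0 ≤ finInv p L x ∧ finInv p L x ≤ 1 := fun x =>
          ⟨finInv_nonneg p L x, by
            have := finInv_add_le_one hp L x
            have : 0 < 1 / (p : ℝ) ^ L := by positivity
            linarith⟩
        have hper := sum_range_periodic_add (finInv_periodic p L)
        -- With the sign fixed, the lower digits enter linearly, and their contributions cancel
        -- because both run over the same complete residue system.
        have hz : ∑ a ∈ Finset.range (p ^ L), (finInv p L ((n + c) / p + a) -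
            finInv p L ((m + c) / p + a)) / p = 0 := by
          rw [← Finset.sum_div, Finset.sum_sub_distrib, hper, hper, sub_self, zero_div]
        rcases lt_or_gt_of_ne hne with hlt | hlt
        · have hlt' : (((n + c) % p : ℕ) : ℝ) + 1 ≤ ((m + c) % p : ℕ) := by exact_mod_cast hlt
          rw [abs_of_neg (by linarith)]
          calc _ = ∑ a ∈ Finset.range (p ^ L),
                (-((((n + c) % p : ℕ) : ℝ) - ((m + c) % p : ℕ)) / p -
                  (finInv p L ((n + c) / p + a) - finInv p L ((m + c) / p + a)) / p) := by
                refine Finset.sum_congr rfl fun a _ => ?_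
                rw [← add_div, ← add_div, ← sub_div, abs_div, abs_of_pos hp', abs_of_nonpos
                  (by linarith [(hbd ((n + c) / p + a)).2, (hbd ((m + c) / p + a)).1])]
                ring
            _ = _ := by
                rw [Finset.sum_sub_distrib, hz]
                simp
        · have hlt' : (((m + c) % p : ℕ) : ℝ) + 1 ≤ ((n + c) % p : ℕ) := by exact_mod_cast hlt
          rw [abs_of_pos (by linarith)]
          calc _ = ∑ a ∈ Finset.range (p ^ L),
                (((((n + c) % p : ℕ) : ℝ) - ((m + c) % p : ℕ)) / p +
                  (finInv p L ((n + c) / p + a) - finInv p L ((m + c) / p + a)) / p) := by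
                refine Finset.sum_congr rfl fun a _ => ?_
                rw [← add_div, ← add_div, ← sub_div, abs_div, abs_of_pos hp', abs_of_nonneg
                  (by linarith [(hbd ((m + c) / p + a)).2, (hbd ((n + c) / p + a)).1])]
                ring
            _ = _ := by
                rw [Finset.sum_add_distrib, hz]
                simp
      rw [Finset.sum_congr rfl fun c _ => h3 c, halfDist_succ_of_not_dvd hp L h, ← Finset.mul_sum,
        ← Finset.sum_div, sum_abs_mod_sub_mod hp]
      field_simp
      ring

/-! ### Averages of bounds for the kernels -/

theorem sum_finInv_add {p : ℕ} (hp : 0 < p) (L n : ℕ) :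
    ∑ a ∈ Finset.range (p ^ L), finInv p L (n + a) = ((p : ℝ) ^ L - 1) / 2 := by
  have hp' : (0 : ℝ) < (p : ℝ) ^ L := by positivity
  have h1 : ∀ M : ℕ, ∑ i ∈ Finset.range M, (i : ℝ) = M * (M - 1) / 2 := by
    intro M
    induction M with
    | zero => simp
    | succ M ih => rw [Finset.sum_range_succ, ih]; push_cast; ring
  rw [sum_comp_finInv hp L n fun x => x, ← Finset.sum_div, h1]
  push_cast
  field_simp

theorem sum_lastCell_add {p : ℕ} (hp : 0 < p) (L n : ℕ) :
    ∑ a ∈ Finset.range (p ^ L), lastCell p L (n + a) = 1 := by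
  have hp' : (0 : ℝ) < (p : ℝ) ^ L := by positivity
  unfold lastCell
  rw [sum_comp_finInv hp L n fun x => if 1 ≤ x + 1 / (p : ℝ) ^ L then (1 : ℝ) else 0]
  have hpos : 0 < p ^ L := by positivity
  rw [Finset.sum_eq_single (p ^ L - 1)]
  · rw [if_pos]
    rw [← add_div, le_div_iff₀ hp', one_mul, Nat.cast_sub hpos]; simp
  · intro i hi hne
    rw [Finset.mem_range] at hi
    rw [if_neg]
    rw [← add_div, not_le, div_lt_one hp']
    have : i + 1 < p ^ L := by omega
    exact_mod_cast this
  · intro h; exact absurd (Finset.mem_range.2 (by omega)) h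

/-- The points here are the right ends `(i + 1)/p^L` of the cells, so the squares sum in closed
form; as `L → ∞` the mean tends to `1/3`. -/
theorem sum_one_sub_sq {p : ℕ} (hp : 0 < p) (L n : ℕ) :
    (∑ a ∈ Finset.range (p ^ L), (1 - (finInv p L (n + a) + 1 / (p : ℝ) ^ L) ^ 2) / 2) /
        (p : ℝ) ^ L =
      (1 - (1 + 1 / (p : ℝ) ^ L) * (2 + 1 / (p : ℝ) ^ L) / 6) / 2 := by
  have hp' : (0 : ℝ) < (p : ℝ) ^ L := by positivity
  have h1 : ∀ M : ℕ, ∑ i ∈ Finset.range M, ((i : ℝ) + 1) ^ 2 =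
      (M : ℝ) * (M + 1) * (2 * M + 1) / 6 := by
    intro M
    induction M with
    | zero => simp
    | succ M ih => rw [Finset.sum_range_succ, ih]; push_cast; ring
  rw [sum_comp_finInv hp L n fun x => (1 - (x + 1 / (p : ℝ) ^ L) ^ 2) / 2, ← Finset.sum_div,
    Finset.sum_sub_distrib]
  simp_rw [← add_div, div_pow]
  rw [← Finset.sum_div, h1]
  simp only [Finset.sum_const, Finset.card_range, nsmul_eq_mul]
  push_cast
  field_simp

/-- Write `max(x, y) = (x + y + |x - y|)/2`. Of the error `5/2 · p^(-L)`, one half comes from the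
mean `(1 - p^(-L))/2` of the grid points and `1` from each of the two last cells. -/
theorem sum_one_sub_max_le {p : ℕ} (hp : 0 < p) (L n m : ℕ) :
    (∑ a ∈ Finset.range (p ^ L), (1 - max (finInv p L (n + a) - lastCell p L (n + a))
        (finInv p L (m + a) - lastCell p L (m + a)))) / (p : ℝ) ^ L ≤
      1 / 2 - halfDist p L ((n : ℤ) - m) + 5 / 2 * (1 / (p : ℝ) ^ L) := by
  have hp' : (0 : ℝ) < (p : ℝ) ^ L := by positivity
  have h0 : ∀ x, 0 ≤ lastCell p L x := fun x => by unfold lastCell; split_ifs <;> norm_num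
  have h1 : ∀ a, 1 - max (finInv p L (n + a) - lastCell p L (n + a))
        (finInv p L (m + a) - lastCell p L (m + a)) ≤
      1 - finInv p L (n + a) / 2 - finInv p L (m + a) / 2 -
        |finInv p L (n + a) - finInv p L (m + a)| / 2 + lastCell p L (n + a) +
        lastCell p L (m + a) := by
    intro a
    have := h0 (n + a)
    have := h0 (m + a)
    rcases abs_cases (finInv p L (n + a) - finInv p L (m + a)) with h | h <;> rw [h.1] <;>
    linarith [le_max_left (finInv p L (n + a) - lastCell p L (n + a))
        (finInv p L (m + a) - lastCell p L (m + a)),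
        le_max_right (finInv p L (n + a) - lastCell p L (n + a))
        (finInv p L (m + a) - lastCell p L (m + a))]
  rw [div_le_iff₀ hp']
  refine (Finset.sum_le_sum fun a _ => h1 a).trans (le_of_eq ?_)
  simp only [Finset.sum_add_distrib, Finset.sum_sub_distrib, ← Finset.sum_div, sum_finInv_add hp,
    sum_lastCell_add hp, sum_abs_finInv_sub hp, Finset.sum_const, Finset.card_range, nsmul_eq_mul]
  push_cast
  field_simp
  ring

/-! ### Cancellation in sums of the kernel coefficients -/

theorem baseCoeff_emod (p : ℕ) (k : ℤ) : baseCoeff p (k % p) = baseCoeff p k := by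
  unfold baseCoeff
  rw [Int.emod_emod_of_dvd _ dvd_rfl]
  have : (p : ℤ) ∣ k % p ↔ (p : ℤ) ∣ k := by
    rw [Int.dvd_iff_emod_eq_zero, Int.emod_emod_of_dvd _ dvd_rfl, Int.dvd_iff_emod_eq_zero]
  simp only [this]

/-- The mean of `c(p - c)/p²` over the residues is `1/6 - 1/(6p²)`; the term `1/(6p)` at multiples
of `p` removes exactly this defect. -/
theorem sum_baseCoeff_range {p : ℕ} (hp : 0 < p) :
    ∑ c ∈ Finset.range p, baseCoeff p c = 0 := by
  have hp' : (0 : ℝ) < p := by exact_mod_cast hp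
  have h1 : ∀ M : ℕ, ∑ c ∈ Finset.range M, (c : ℝ) * (p - c) =
      p * (M * (M - 1) / 2) - M * (M - 1) * (2 * M - 1) / 6 := by
    intro M
    induction M with
    | zero => simp
    | succ M ih => rw [Finset.sum_range_succ, ih]; push_cast; ring
  have h2 : ∀ c ∈ Finset.range p, baseCoeff p c =
      1 / 6 - (c : ℝ) * (p - c) / (p : ℝ) ^ 2 - if c = 0 then 1 / (6 * (p : ℝ)) else 0 := by
    intro c hc
    rw [Finset.mem_range] at hc
    have h3 : (c : ℤ) % p = c := by exact_mod_cast Nat.mod_eq_of_lt hc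
    have h4 : (p : ℤ) ∣ (c : ℤ) ↔ c = 0 := by
      rw [Int.natCast_dvd_natCast]
      exact ⟨fun h => Nat.eq_zero_of_dvd_of_lt h hc, fun h => h ▸ dvd_zero p⟩
    rw [baseCoeff, h3]
    simp only [h4, Int.cast_natCast]
  rw [Finset.sum_congr rfl h2, Finset.sum_sub_distrib, Finset.sum_sub_distrib,
    ← Finset.sum_div _ (fun c : ℕ => (c : ℝ) * (p - c)) ((p : ℝ) ^ 2), h1, Finset.sum_ite_eq']
  simp only [Finset.mem_range, hp, if_true, Finset.sum_const, Finset.card_range, nsmul_eq_mul]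
  field_simp
  ring

theorem sum_baseCoeff_progression {p : ℕ} (hp : p.Prime) {u : ℤ} (hu : ¬ (p : ℤ) ∣ u) (k : ℤ) :
    ∑ t ∈ Finset.range p, baseCoeff p (k + u * t) = 0 := by
  have hp0 : (0 : ℤ) < p := by exact_mod_cast hp.pos
  rw [← sum_baseCoeff_range hp.pos]
  have hcast : ∀ t : ℕ, ((((k + u * t) % p).toNat : ℕ) : ℤ) = (k + u * t) % p := fun t =>
    Int.toNat_of_nonneg (Int.emod_nonneg _ hp0.ne')
  have hmaps : Set.MapsTo (fun t : ℕ => ((k + u * t) % p).toNat) (Finset.range p)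
      (Finset.range p) := by
    intro t _
    simp only [Finset.coe_range, Set.mem_Iio]
    zify
    rw [hcast]
    exact Int.emod_lt_of_pos _ hp0
  have hinj : Set.InjOn (fun t : ℕ => ((k + u * t) % p).toNat) (Finset.range p) := by
    intro t ht t' ht' h
    simp only [Finset.coe_range, Set.mem_Iio] at ht ht'
    have h1 : (k + u * t) % p = (k + u * t') % p :=
      (hcast t).symm.trans ((congrArg Nat.cast h).trans (hcast t'))
    have h2 : (p : ℤ) ∣ u * ((t' : ℤ) - t) := by
      have h3 := Int.ModEq.dvd (show k + u * t ≡ k + u * t' [ZMOD p] from h1)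
      convert h3 using 1; ring
    rcases (Nat.prime_iff_prime_int.1 hp).dvd_or_dvd h2 with h3 | h3
    · exact absurd h3 hu
    · have := Int.eq_zero_of_abs_lt_dvd h3 (by rw [abs_lt]; constructor <;> omega)
      omega
  refine Finset.sum_nbij (fun t => ((k + u * t) % p).toNat) hmaps hinj
    (Finset.surjOn_of_injOn_of_card_le _ hmaps hinj le_rfl) fun t _ => ?_
  rw [hcast, baseCoeff_emod]

theorem abs_baseCoeff_le {p : ℕ} (hp : 0 < p) (k : ℤ) : |baseCoeff p k| ≤ 1 / 6 := by
  have hp' : (1 : ℝ) ≤ p := by exact_mod_cast hp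
  have hp0 : (0 : ℤ) < p := by exact_mod_cast hp
  unfold baseCoeff
  split_ifs with h
  · rw [Int.emod_eq_zero_of_dvd h, Int.cast_zero, zero_mul, zero_div, sub_zero]
    have h1 : 1 / (6 * (p : ℝ)) ≤ 1 / 6 := by
      apply one_div_le_one_div_of_le <;> linarith
    have h2 : 0 < 1 / (6 * (p : ℝ)) := by positivity
    rw [abs_le]; constructor <;> linarith
  · have h1 : (0 : ℝ) ≤ ((k % p : ℤ) : ℝ) := by exact_mod_cast Int.emod_nonneg k hp0.ne'
    have h2 : ((k % p : ℤ) : ℝ) ≤ p := by exact_mod_cast (Int.emod_lt_of_pos k hp0).le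
    set c : ℝ := ((k % p : ℤ) : ℝ)
    have h3 : c * (p - c) / (p : ℝ) ^ 2 ≤ 1 / 4 := by
      rw [div_le_iff₀ (by positivity)]; nlinarith [sq_nonneg (c - p / 2)]
    have h4 : 0 ≤ c * (p - c) / (p : ℝ) ^ 2 := by
      have : 0 ≤ p - c := by linarith
      positivity
    rw [abs_le]; constructor <;> linarith

theorem levelCoeff_add_mul {p : ℕ} (hp : 0 < p) (r : ℕ) (k t : ℤ) :
    levelCoeff p r (k + (p : ℤ) ^ (r + 1) * t) = levelCoeff p r k := by
  have hp0 : (p : ℤ) ^ r ≠ 0 := by positivity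
  have h1 : (p : ℤ) ^ r ∣ k + (p : ℤ) ^ (r + 1) * t ↔ (p : ℤ) ^ r ∣ k :=
    Int.dvd_add_left ((pow_dvd_pow _ r.le_succ).mul_right t)
  unfold levelCoeff
  simp only [h1]
  split_ifs with h
  · congr 1
    rw [pow_succ, mul_assoc, Int.add_mul_ediv_left _ _ hp0, ← baseCoeff_emod,
      Int.add_mul_emod_self_left, baseCoeff_emod]
  · rfl

theorem sum_levelCoeff_progression {p : ℕ} (hp : p.Prime) (r : ℕ) {u : ℤ} (hu : ¬ (p : ℤ) ∣ u)
    (k : ℤ) : ∑ t ∈ Finset.range p, levelCoeff p r (k + (p : ℤ) ^ r * u * t) = 0 := by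
  have hp0 : (p : ℤ) ^ r ≠ 0 := pow_ne_zero _ (by exact_mod_cast hp.ne_zero)
  have h1 : ∀ t : ℕ, (p : ℤ) ^ r ∣ k + (p : ℤ) ^ r * u * t ↔ (p : ℤ) ^ r ∣ k := fun t =>
    Int.dvd_add_left ((dvd_mul_right _ _).mul_right _)
  unfold levelCoeff
  simp only [h1]
  split_ifs with h
  · rw [← Finset.sum_div]
    have h2 : ∀ t : ℕ, (k + (p : ℤ) ^ r * u * t) / (p : ℤ) ^ r =
        k / (p : ℤ) ^ r + u * t := fun t => by
      rw [mul_assoc, Int.add_mul_ediv_left _ _ hp0]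
    simp_rw [h2]
    rw [sum_baseCoeff_progression hp hu, zero_div]
  · simp

theorem abs_levelCoeff_le {p : ℕ} (hp : 0 < p) (r : ℕ) (k : ℤ) :
    |levelCoeff p r k| ≤ if (p : ℤ) ^ r ∣ k then 1 / 6 / (p : ℝ) ^ r else 0 := by
  unfold levelCoeff
  split_ifs
  · rw [abs_div, abs_of_pos (show (0 : ℝ) < (p : ℝ) ^ r by positivity)]
    gcongr
    exact abs_baseCoeff_le hp _
  · simp

section Counting

variable {ι : Type*} [DecidableEq ι]

/-- Single out one `i ∈ J` and sum first along the step `p_i^{r_i} u`, where `u` is the product of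
the other periods. The other factors are constant along this progression, and since `p_i ∤ u` the
factor of `i` sums to zero. -/
theorem sum_prod_levelCoeff_period {p r : ι → ℕ} (hp : ∀ j, (p j).Prime)
    (hinj : Function.Injective p) {J : Finset ι} (hJ : J.Nonempty) (a : ℤ) :
    ∑ m ∈ Finset.range (∏ j ∈ J, p j ^ (r j + 1)),
      ∏ j ∈ J, levelCoeff (p j) (r j) (a - m) = 0 := by
  obtain ⟨i, hi⟩ := hJ
  set u := ∏ j ∈ J.erase i, p j ^ (r j + 1) with hu
  have hui : ¬ ((p i : ℕ) : ℤ) ∣ -(u : ℤ) := by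
    rw [Int.dvd_neg, Int.natCast_dvd_natCast, hu, (hp i).prime.dvd_finsetProd_iff]
    rintro ⟨j, hj, hd⟩
    have := (Nat.prime_dvd_prime_iff_eq (hp i) (hp j)).1 ((hp i).dvd_of_dvd_pow hd)
    exact (Finset.ne_of_mem_erase hj) (hinj this).symm
  have hP : ∏ j ∈ J, p j ^ (r j + 1) = p i * (p i ^ r i * u) := by
    rw [← Finset.mul_prod_erase _ _ hi, pow_succ, mul_comm (p i ^ r i), mul_assoc]
  rw [hP, sum_range_mul_eq, Finset.sum_comm]
  refine Finset.sum_eq_zero fun c _ => ?_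
  have h1 : ∀ t ∈ Finset.range (p i), ∏ j ∈ J, levelCoeff (p j) (r j)
      (a - ((c + p i ^ r i * u * t : ℕ) : ℤ)) =
      levelCoeff (p i) (r i) ((a - c) + (p i : ℤ) ^ r i * (-(u : ℤ)) * t) *
        ∏ j ∈ J.erase i, levelCoeff (p j) (r j) (a - c) := by
    intro t _
    rw [← Finset.mul_prod_erase _ _ hi]
    congr 1
    · congr 1; push_cast; ring
    · refine Finset.prod_congr rfl fun j hj => ?_
      obtain ⟨v, hv⟩ : p j ^ (r j + 1) ∣ u := Finset.dvd_prod_of_mem _ hj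
      rw [← levelCoeff_add_mul (hp j).pos (r j) (a - c) (-((p i : ℤ) ^ r i * v * t)), hv]
      congr 1; push_cast; ring
  rw [Finset.sum_congr rfl h1, ← Finset.sum_mul, sum_levelCoeff_progression (hp i) _ hui, zero_mul]

/-- Enlarging the square from `N` to `N + P` adds strips, on each of which one of the two indices
runs over a full period. -/
theorem double_sum_periodic {G : ℤ → ℝ} {P : ℕ}
    (hG : ∀ a : ℤ, ∑ m ∈ Finset.range P, G (a - m) = 0) :
    Function.Periodic
      (fun N : ℕ => ∑ n ∈ Finset.range N, ∑ m ∈ Finset.range N, G ((n : ℤ) - m)) P := by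
  intro N
  have h1 : ∀ a : ℤ, ∑ n ∈ Finset.range P, G (a + n) = 0 := by
    intro a
    rw [← hG (a + P - 1), ← Finset.sum_range_reflect]
    refine Finset.sum_congr rfl fun n hn => ?_
    rw [Finset.mem_range] at hn
    congr 1; omega
  have h2 : ∀ n : ℕ, ∑ m ∈ Finset.range (N + P), G ((n : ℤ) - m) =
      ∑ m ∈ Finset.range N, G ((n : ℤ) - m) := by
    intro n
    rw [Finset.sum_range_add, add_eq_left, ← hG ((n : ℤ) - N)]
    refine Finset.sum_congr rfl fun m _ => ?_
    congr 1; push_cast; ring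
  simp only [h2]
  rw [Finset.sum_range_add, add_eq_left, Finset.sum_comm]
  refine Finset.sum_eq_zero fun m _ => ?_
  rw [← h1 ((N : ℤ) - m)]
  refine Finset.sum_congr rfl fun n _ => ?_
  congr 1; push_cast; ring

theorem card_filter_dvd_sub_le {b Q P : ℕ} (hb : b ≤ Q * P) (n : ℤ) :
    ((Finset.range b).filter fun m : ℕ => (Q : ℤ) ∣ n - m).card ≤ P := by
  rw [← Finset.card_range P]
  refine Finset.card_le_card_of_injOn (fun m => m / Q) ?_ ?_
  · intro m hm
    simp only [Finset.coe_filter, Finset.mem_range, Set.mem_ofPred_eq] at hm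
    simp only [Finset.coe_range, Set.mem_Iio]
    exact Nat.div_lt_of_lt_mul (hm.1.trans_le hb)
  · intro m hm m' hm' h
    simp only [Finset.coe_filter, Finset.mem_range, Set.mem_ofPred_eq] at hm hm'
    have h1 : m ≡ m' [MOD Q] := by
      rw [Nat.modEq_iff_dvd]
      simpa using dvd_sub hm.2 hm'.2
    have h1 : m % Q = m' % Q := h1
    have h2 : m / Q = m' / Q := h
    rw [← Nat.div_add_mod m Q, ← Nat.div_add_mod m' Q, h1, h2]

theorem min_prod_le_prod_min (p : ι → ℕ) {N : ℕ} (hN : 1 ≤ N) (J : Finset ι)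
    (hp : ∀ j, 1 ≤ p j) : min (∏ j ∈ J, p j) N ≤ ∏ j ∈ J, min (p j) N := by
  induction J using Finset.induction_on with
  | empty => simp
  | insert a J ha ih =>
    rw [Finset.prod_insert ha, Finset.prod_insert ha]
    refine le_trans ?_ (Nat.mul_le_mul_left _ ih)
    have h1 : 1 ≤ ∏ j ∈ J, p j := Finset.one_le_prod' fun j _ => hp j
    have h2 := hp a
    rcases le_total (p a) N with h | h <;> rcases le_total (∏ j ∈ J, p j) N with h' | h'
    · rw [min_eq_left h, min_eq_left h']; exact min_le_left _ _
    · rw [min_eq_left h, min_eq_right h']; exact (min_le_right _ _).trans (by nlinarith)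
    · rw [min_eq_right h, min_eq_left h']; exact (min_le_right _ _).trans (by nlinarith)
    · rw [min_eq_right h, min_eq_right h']; exact (min_le_right _ _).trans (by nlinarith)

/-- The uniformity in the levels `r` is the point. Reduce `N` modulo `QP` to `b`. The summand is at
most `6^(-|J|)/Q` and lives on `Q ∣ n - m`, so each of the `b` rows has at most `min(P, N)` nonzero
terms, and `b/Q ≤ min(P, N)`: the powers of `Q` cancel. -/
theorem abs_double_sum_prod_levelCoeff_le {p r : ι → ℕ} (hp : ∀ j, (p j).Prime)
    (hinj : Function.Injective p) {J : Finset ι} (hJ : J.Nonempty) {N : ℕ} (hN : 1 ≤ N) :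
    |∑ n ∈ Finset.range N, ∑ m ∈ Finset.range N,
      ∏ j ∈ J, levelCoeff (p j) (r j) ((n : ℤ) - m)| ≤
      ∏ j ∈ J, ((min (p j) N : ℕ) : ℝ) ^ 2 / 6 := by
  set G : ℤ → ℝ := fun k => ∏ j ∈ J, levelCoeff (p j) (r j) k with hG
  set Q := ∏ j ∈ J, p j ^ r j with hQ
  set P := ∏ j ∈ J, p j with hP
  have hQpos : 0 < Q := Finset.prod_pos fun j _ => pow_pos (hp j).pos _
  have hQP : ∏ j ∈ J, p j ^ (r j + 1) = Q * P := by
    rw [hQ, hP, ← Finset.prod_mul_distrib]; simp_rw [pow_succ]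
  have hper := double_sum_periodic (G := G) (sum_prod_levelCoeff_period (r := r) hp hinj hJ)
  rw [hQP] at hper
  have hmod := hper.map_mod_nat N
  change |∑ n ∈ Finset.range N, ∑ m ∈ Finset.range N, G ((n : ℤ) - m)| ≤ _
  rw [← hmod]
  set b := N % (Q * P) with hb
  have hPpos : 0 < P := Finset.prod_pos fun j _ => (hp j).pos
  have hbP : b ≤ Q * P := (Nat.mod_lt _ (Nat.mul_pos hQpos hPpos)).le
  have hbN : b ≤ N := Nat.mod_le _ _
  have hGb : ∀ k : ℤ, |G k| ≤ if (Q : ℤ) ∣ k then (∏ _j ∈ J, (1 / 6 : ℝ)) / Q else 0 := by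
    intro k
    rw [hG]; simp only
    rw [Finset.abs_prod]
    refine (Finset.prod_le_prod (fun _ _ => abs_nonneg _) fun j _ =>
      abs_levelCoeff_le (hp j).pos (r j) k).trans ?_
    split_ifs with h
    · refine (Finset.prod_le_prod (fun j _ => ?_)
        fun j _ => (?_ : _ ≤ 1 / 6 / (p j : ℝ) ^ r j)).trans (le_of_eq ?_)
      · split_ifs <;> positivity
      · split_ifs
        · exact le_rfl
        · positivity
      · rw [Finset.prod_div_distrib, hQ]; push_cast; rfl
    · have : ∃ j ∈ J, ¬ (p j : ℤ) ^ r j ∣ k := by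
        by_contra hc
        push Not at hc
        apply h
        rw [hQ]; push_cast
        refine Finset.prod_dvd_of_coprime ?_ hc
        intro i _ j _ hij
        refine IsCoprime.pow ?_
        rw [Nat.isCoprime_iff_coprime]
        exact (Nat.coprime_primes (hp i) (hp j)).2 fun he => hij (hinj he)
      obtain ⟨j, hj, hd⟩ := this
      exact (Finset.prod_eq_zero hj (if_neg hd)).le
  have hcount : ∀ n : ℕ, ∑ m ∈ Finset.range b, |G ((n : ℤ) - m)| ≤
      ((min P N : ℕ) : ℝ) * ((∏ _j ∈ J, (1 / 6 : ℝ)) / Q) := by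
    intro n
    refine (Finset.sum_le_sum fun m _ => hGb _).trans ?_
    rw [← Finset.sum_filter, Finset.sum_const, nsmul_eq_mul]
    gcongr
    refine le_min (card_filter_dvd_sub_le hbP _) ?_
    exact ((Finset.card_filter_le _ _).trans (Finset.card_range b).le).trans hbN
  have hbQ : (b : ℝ) / Q ≤ ((min P N : ℕ) : ℝ) := by
    have hQ' : (1 : ℝ) ≤ Q := by exact_mod_cast hQpos
    rw [div_le_iff₀ (by linarith)]
    have : b ≤ min P N * Q := by
      rcases le_total P N with h | h
      · rw [min_eq_left h, mul_comm]; exact hbP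
      · rw [min_eq_right h]; exact hbN.trans (Nat.le_mul_of_pos_right N hQpos)
    exact_mod_cast this
  calc |∑ n ∈ Finset.range b, ∑ m ∈ Finset.range b, G ((n : ℤ) - m)|
      ≤ ∑ n ∈ Finset.range b, ∑ m ∈ Finset.range b, |G ((n : ℤ) - m)| :=
        (Finset.abs_sum_le_sum_abs _ _).trans
          (Finset.sum_le_sum fun n _ => Finset.abs_sum_le_sum_abs _ _)
    _ ≤ ∑ _n ∈ Finset.range b, ((min P N : ℕ) : ℝ) * ((∏ _j ∈ J, (1 / 6 : ℝ)) / Q) :=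
        Finset.sum_le_sum fun n _ => hcount n
    _ = (b : ℝ) / Q * ((min P N : ℕ) : ℝ) * ∏ _j ∈ J, (1 / 6 : ℝ) := by
        rw [Finset.sum_const, Finset.card_range, nsmul_eq_mul]; ring
    _ ≤ ((min P N : ℕ) : ℝ) * ((min P N : ℕ) : ℝ) * ∏ _j ∈ J, (1 / 6 : ℝ) := by gcongr
    _ ≤ ((∏ j ∈ J, min (p j) N : ℕ) : ℝ) * ((∏ j ∈ J, min (p j) N : ℕ) : ℝ) *
          ∏ _j ∈ J, (1 / 6 : ℝ) := by
        have := min_prod_le_prod_min p hN J fun j => (hp j).one_le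
        gcongr
    _ = _ := by
        rw [Nat.cast_prod, ← Finset.prod_mul_distrib, ← Finset.prod_mul_distrib]
        exact Finset.prod_congr rfl fun j _ => by ring

end Counting

/-! ### The bound for the shift-averaged kernel sum -/

/-- Each term of the telescoped difference contains some `t j`, so one factor `c` can be extracted.
With `c = 1/N` it offsets the number `N` of diagonal terms. -/
theorem prod_sub_prod_sub_le {ι : Type*} (J : Finset ι) {X t w : ι → ℝ} {c : ℝ}
    (hc : 0 ≤ c) (hX : ∀ j, 1 ≤ X j) (ht : ∀ j, 0 ≤ t j) (htX : ∀ j, t j ≤ X j)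
    (hw : ∀ j, 0 ≤ w j) (htw : ∀ j, t j ≤ c * w j) :
    ∏ j ∈ J, X j - ∏ j ∈ J, (X j - t j) ≤ c * ((∏ j ∈ J, X j) * ∏ j ∈ J, (1 + w j)) := by
  classical
  induction J using Finset.induction_on with
  | empty => simpa using hc
  | insert a J ha ih =>
    rw [Finset.prod_insert ha, Finset.prod_insert ha, Finset.prod_insert ha]
    have h1 : ∏ j ∈ J, (X j - t j) ≤ ∏ j ∈ J, X j := Finset.prod_le_prod
      (fun j _ => sub_nonneg.2 (htX j)) fun j _ => by linarith [ht j]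
    have h2 : (1 : ℝ) ≤ ∏ j ∈ J, (1 + w j) := by
      calc (1 : ℝ) = ∏ _j ∈ J, (1 : ℝ) := by simp
        _ ≤ _ := Finset.prod_le_prod (fun _ _ => zero_le_one) fun j _ => by linarith [hw j]
    have h3 : 0 ≤ ∏ j ∈ J, X j := Finset.prod_nonneg fun j _ => by linarith [hX j]
    set A := ∏ j ∈ J, X j
    set B := ∏ j ∈ J, (X j - t j)
    set W := ∏ j ∈ J, (1 + w j)
    have hXa := hX a
    calc X a * A - (X a - t a) * B = X a * (A - B) + t a * B := by ring
      _ ≤ X a * (c * (A * W)) + t a * A :=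
          add_le_add (mul_le_mul_of_nonneg_left ih (by linarith))
            (mul_le_mul_of_nonneg_left h1 (ht a))
      _ ≤ X a * (c * (A * W)) + c * w a * (X a * A * W) := by
          have h4 : A ≤ X a * A * W := by
            have : A ≤ X a * A := le_mul_of_one_le_left h3 hXa
            exact this.trans (le_mul_of_one_le_right (by nlinarith) h2)
          have := mul_le_mul (htw a) h4 h3 (mul_nonneg hc (hw a))
          linarith
      _ = c * (X a * A * ((1 + w a) * W)) := by ring

theorem double_sum_prod_levels_le {s : ℕ} {p : Fin s → ℕ} (hp : ∀ j, (p j).Prime)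
    (hinj : Function.Injective p) {γ b : Fin s → ℝ} (hγ : ∀ j, 0 < γ j) (hb : ∀ j, 0 ≤ b j)
    (g : Fin s → ℕ) {N : ℕ} (hN : 1 ≤ N) :
    ∑ n ∈ Finset.range N, ∑ m ∈ Finset.range N,
      ∏ j, (∑ r ∈ Finset.range (g j), γ j * levelCoeff (p j) r ((n : ℤ) - m) + b j) -
      (N : ℝ) ^ 2 * ∏ j, b j ≤
    ∏ j, (g j * (γ j * (((min (p j) N : ℕ) : ℝ) ^ 2 / 6)) + b j) - ∏ j, b j := by
  -- To multiply out, index the choice in coordinate `j` by `x`: `0` selects the constant `b j`, and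
  -- `r + 1` selects level `r`. The all-zero choice is the subtracted main term.
  set f : ℤ → Fin s → ℕ → ℝ := fun k j x =>
    Nat.casesOn x (b j) fun r => γ j * levelCoeff (p j) r k with hf
  set W : Fin s → ℕ → ℝ := fun j x =>
    Nat.casesOn x (b j) fun _ => γ j * (((min (p j) N : ℕ) : ℝ) ^ 2 / 6) with hW
  have h1 : ∀ k : ℤ, ∏ j, (∑ r ∈ Finset.range (g j), γ j * levelCoeff (p j) r k + b j) =
      ∑ x ∈ Fintype.piFinset fun j => Finset.range (g j + 1), ∏ j, f k j (x j) := by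
    intro k
    rw [← Finset.prod_univ_sum]
    refine Finset.prod_congr rfl fun j _ => ?_
    rw [Finset.sum_range_succ']
    rfl
  have h2 : ∏ j, (g j * (γ j * (((min (p j) N : ℕ) : ℝ) ^ 2 / 6)) + b j) =
      ∑ x ∈ Fintype.piFinset fun j => Finset.range (g j + 1), ∏ j, W j (x j) := by
    rw [← Finset.prod_univ_sum]
    refine Finset.prod_congr rfl fun j _ => ?_
    rw [Finset.sum_range_succ']
    simp [hW]
  have h0 : (0 : Fin s → ℕ) ∈ Fintype.piFinset fun j => Finset.range (g j + 1) := by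
    simp [Fintype.mem_piFinset]
  have h3 : ∑ n ∈ Finset.range N, ∑ m ∈ Finset.range N,
      ∏ j, (∑ r ∈ Finset.range (g j), γ j * levelCoeff (p j) r ((n : ℤ) - m) + b j) =
      ∑ x ∈ Fintype.piFinset fun j => Finset.range (g j + 1),
        ∑ n ∈ Finset.range N, ∑ m ∈ Finset.range N, ∏ j, f ((n : ℤ) - m) j (x j) := by
    simp_rw [h1]
    rw [Finset.sum_congr rfl fun n _ => Finset.sum_comm, Finset.sum_comm]
  rw [h3, h2, ← Finset.add_sum_erase _ _ h0, ← Finset.add_sum_erase _ _ h0]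
  have h4 : ∑ n ∈ Finset.range N, ∑ m ∈ Finset.range N, ∏ j, f ((n : ℤ) - m) j
      ((0 : Fin s → ℕ) j) = (N : ℝ) ^ 2 * ∏ j, b j := by
    simp [hf]; ring
  have h5 : ∏ j, W j ((0 : Fin s → ℕ) j) = ∏ j, b j := by simp [hW]
  rw [h4, h5, add_sub_cancel_left, add_sub_cancel_left]
  refine Finset.sum_le_sum fun x hx => ?_
  set J := Finset.univ.filter fun j => x j ≠ 0 with hJ
  have hJne : J.Nonempty := by
    obtain ⟨j, hj⟩ := Function.ne_iff.1 (Finset.ne_of_mem_erase hx)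
    exact ⟨j, by simpa [hJ] using hj⟩
  have h6 : ∀ k, ∏ j, f k j (x j) = ((∏ j ∈ Jᶜ, b j) * ∏ j ∈ J, γ j) *
      ∏ j ∈ J, levelCoeff (p j) (x j - 1) k := by
    intro k
    rw [← Finset.prod_mul_prod_compl J, mul_comm, mul_assoc, ← Finset.prod_mul_distrib]
    congr 1
    · refine Finset.prod_congr rfl fun j hj => ?_
      have : x j = 0 := by simpa [hJ] using hj
      simp [hf, this]
    · refine Finset.prod_congr rfl fun j hj => ?_
      have : x j ≠ 0 := by simpa [hJ] using hj
      obtain ⟨y, hy⟩ := Nat.exists_eq_succ_of_ne_zero this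
      simp [hf, hy]
  have h7 : ∏ j, W j (x j) = ((∏ j ∈ Jᶜ, b j) * ∏ j ∈ J, γ j) *
      ∏ j ∈ J, ((min (p j) N : ℕ) : ℝ) ^ 2 / 6 := by
    rw [← Finset.prod_mul_prod_compl J, mul_comm, mul_assoc, ← Finset.prod_mul_distrib]
    congr 1
    · refine Finset.prod_congr rfl fun j hj => ?_
      have : x j = 0 := by simpa [hJ] using hj
      simp [hW, this]
    · refine Finset.prod_congr rfl fun j hj => ?_
      have : x j ≠ 0 := by simpa [hJ] using hj
      obtain ⟨y, hy⟩ := Nat.exists_eq_succ_of_ne_zero this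
      simp [hW, hy]
  simp_rw [h6, ← Finset.mul_sum]
  rw [h7]
  refine mul_le_mul_of_nonneg_left ?_ (mul_nonneg (Finset.prod_nonneg fun j _ => hb j)
    (Finset.prod_nonneg fun j _ => (hγ j).le))
  exact (le_abs_self _).trans
    (abs_double_sum_prod_levelCoeff_le (r := fun j => x j - 1) hp hinj hJne hN)

/-- Compares the level count times the bound per level with the logarithmic factor of the theorem.
The extra `1/3` absorbs the `γ_j/3` in the constant `1 + γ_j/3`. -/
theorem clog_mul_min_sq_le {p N : ℕ} (hp : 2 ≤ p) (hN : 2 ≤ N) :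
    (Nat.clog p N : ℝ) * (((min p N : ℕ) : ℝ) ^ 2 / 6) + 1 / 3 ≤
      Real.log N * ((p : ℝ) ^ 2 / Real.log p) := by
  have hp' : (2 : ℝ) ≤ p := by exact_mod_cast hp
  have hN' : (2 : ℝ) ≤ N := by exact_mod_cast hN
  have hlp : 0 < Real.log p := Real.log_pos (by linarith)
  have hlN : 0 < Real.log N := Real.log_pos (by linarith)
  rcases le_total p N with h | h
  · have hpN : (p : ℝ) ≤ N := by exact_mod_cast h
    have h1 : ((Nat.clog p N : ℝ) - 1) * Real.log p ≤ Real.log N := by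
      have h2 : p ^ (Nat.clog p N).pred ≤ N := (Nat.pow_pred_clog_lt_self (by omega) (by omega)).le
      have h3 : ((p : ℝ) ^ (Nat.clog p N).pred) ≤ N := by exact_mod_cast h2
      have h4 := Real.log_le_log (by positivity) h3
      rw [Real.log_pow] at h4
      have h5 : 0 < Nat.clog p N := Nat.clog_pos (by omega) (by omega)
      have h6 : (((Nat.clog p N).pred : ℕ) : ℝ) = Nat.clog p N - 1 := by
        rw [Nat.pred_eq_sub_one, Nat.cast_sub h5]; simp
      rwa [h6] at h4
    have h2 : Real.log p ≤ Real.log N := Real.log_le_log (by linarith) hpN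
    rw [min_eq_left h, mul_div_assoc' (Real.log N), le_div_iff₀ hlp]
    have h3 : (Nat.clog p N : ℝ) * Real.log p ≤ 2 * Real.log N := by linarith
    have h4 : (4 : ℝ) ≤ (p : ℝ) ^ 2 := by nlinarith
    nlinarith [mul_le_mul_of_nonneg_right h3 (sq_nonneg (p : ℝ)),
      mul_le_mul_of_nonneg_left h4 hlN.le]
  · have hpN : (N : ℝ) ≤ p := by exact_mod_cast h
    have h1 : (Nat.clog p N : ℝ) ≤ 1 := by
      exact_mod_cast Nat.clog_le_of_le_pow (b := p) (x := N) (y := 1) (by simpa using h)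
    -- For `N ≤ p` there is at most one level, and `p²/log p` is bounded below by `N²/log N` because
    -- `log x / x²` decreases from `exp (1/2) < 2` on.
    have h2 := Real.log_div_self_rpow_antitoneOn (a := 2) (by norm_num)
    have hexp : Real.exp (2⁻¹) ≤ 2 := by
      rw [← Real.le_log_iff_exp_le (by norm_num)]; linarith [Real.log_two_gt_d9]
    have h3 := h2 (a := (N : ℝ)) (b := (p : ℝ)) (Set.mem_Ici.2 (hexp.trans hN'))
      (Set.mem_Ici.2 (hexp.trans hp')) hpN
    simp only [Real.rpow_two] at h3
    rw [div_le_div_iff₀ (by positivity) (by positivity)] at h3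
    have h4 : (N : ℝ) ^ 2 ≤ Real.log N * ((p : ℝ) ^ 2 / Real.log p) := by
      rw [mul_div_assoc', le_div_iff₀ hlp]; linarith
    rw [min_eq_right h]
    nlinarith [sq_nonneg (N : ℝ)]

theorem double_sum_prod_kernel_le {s : ℕ} {p : Fin s → ℕ} (hp : ∀ j, (p j).Prime)
    (hinj : Function.Injective p) {γ : Fin s → ℝ} (hγ : ∀ j, 0 < γ j) {N : ℕ} (hN : 1 ≤ N) :
    ∑ n ∈ Finset.range N, ∑ m ∈ Finset.range N,
      ∏ j, (1 + γ j * (1 / 2 - halfDist (p j) (Nat.clog (p j) N) ((n : ℤ) - m))) -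
      (N : ℝ) ^ 2 * ∏ j, (1 + γ j / 3) ≤
    ∏ j, (1 + γ j * Real.log N * ((p j : ℝ) ^ 2 / Real.log (p j))) +
      (∏ j, (1 + γ j / 2)) * ∏ j, (1 + γ j * (p j : ℝ) / 6) := by
  set g : Fin s → ℕ := fun j => Nat.clog (p j) N with hg
  have hgN : ∀ j, N ≤ p j ^ g j := fun j => Nat.le_pow_clog (hp j).one_lt N
  have hN' : (0 : ℝ) < N := by exact_mod_cast hN
  -- On the diagonal the kernel factor is `1 + γ_j/2`, whereas the constant plus all levels gives `1
  -- + γ_j/2 - t j`. Off the diagonal `p_j^(g j) ≥ N` cannot divide `n - m`, so `D` is needed only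
  -- for `n = m`.
  set t : Fin s → ℝ := fun j => γ j * (1 / (6 * (p j : ℝ) ^ g j)) with ht
  have hpw : ∀ j, (0 : ℝ) < (p j : ℝ) ^ g j := fun j => pow_pos (by exact_mod_cast (hp j).pos) _
  set D := (∏ j, (1 + γ j / 2)) - ∏ j, ((1 + γ j / 2) - t j) with hD
  set A : ℤ → ℝ := fun k =>
    ∏ j, (∑ r ∈ Finset.range (g j), γ j * levelCoeff (p j) r k + (1 + γ j / 3)) with hA
  have h1 : ∀ k : ℤ, |k| < N → ∏ j, (1 + γ j * (1 / 2 - halfDist (p j) (g j) k)) =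
      A k + if k = 0 then D else 0 := by
    intro k hk
    split_ifs with h0
    · subst h0
      have h2 : A 0 = ∏ j, ((1 + γ j / 2) - t j) := by
        refine Finset.prod_congr rfl fun j _ => ?_
        have := halfDist_zero_right (hp j).pos (g j)
        rw [halfDist, if_pos (dvd_zero _)] at this
        rw [← Finset.mul_sum, ht]
        linear_combination (-γ j) * this
      rw [h2, hD, add_sub_cancel]
      refine Finset.prod_congr rfl fun j _ => ?_
      rw [halfDist_zero_right (hp j).pos]
      ring
    · rw [add_zero]
      refine Finset.prod_congr rfl fun j _ => ?_
      have h2 : ¬ (p j : ℤ) ^ g j ∣ k := fun h =>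
        h0 (Int.eq_zero_of_abs_lt_dvd h (hk.trans_le (by exact_mod_cast hgN j)))
      rw [halfDist, if_neg h2, ← Finset.mul_sum]
      ring
  have h2 : ∑ n ∈ Finset.range N, ∑ m ∈ Finset.range N,
      ∏ j, (1 + γ j * (1 / 2 - halfDist (p j) (g j) ((n : ℤ) - m))) =
      ∑ n ∈ Finset.range N, ∑ m ∈ Finset.range N, A ((n : ℤ) - m) + N * D := by
    have h3 : ∀ n ∈ Finset.range N, ∑ m ∈ Finset.range N,
      ∏ j, (1 + γ j * (1 / 2 - halfDist (p j) (g j) ((n : ℤ) - m))) =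
        ∑ m ∈ Finset.range N, A ((n : ℤ) - m) + D := by
      intro n hn
      have h4 : ∀ m ∈ Finset.range N,
          ∏ j, (1 + γ j * (1 / 2 - halfDist (p j) (g j) ((n : ℤ) - m))) =
          A ((n : ℤ) - m) + if m = n then D else 0 := by
        intro m hm
        rw [Finset.mem_range] at hn hm
        rw [h1 _ (by rw [abs_lt]; constructor <;> omega)]
        have : (n : ℤ) - m = 0 ↔ m = n := by omega
        simp only [this]
      rw [Finset.sum_congr rfl h4, Finset.sum_add_distrib, Finset.sum_ite_eq', if_pos hn]
    rw [Finset.sum_congr rfl h3, Finset.sum_add_distrib]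
    simp
  have h3 : (N : ℝ) * D ≤ (∏ j, (1 + γ j / 2)) * ∏ j, (1 + γ j * (p j : ℝ) / 6) := by
    have htle : ∀ j, t j ≤ 1 / N * (γ j * (p j : ℝ) / 6) := by
      intro j
      have h4 : (N : ℝ) ≤ (p j : ℝ) ^ g j := by exact_mod_cast hgN j
      have h5 : (1 : ℝ) ≤ p j := by exact_mod_cast (hp j).one_le
      have h6 := hγ j
      calc t j ≤ γ j * (1 / (6 * N)) := by rw [ht]; simp only; gcongr
        _ = 1 / N * (γ j * 1 / 6) := by field_simp
        _ ≤ _ := by gcongr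
    have := prod_sub_prod_sub_le (Finset.univ : Finset (Fin s)) (X := fun j => 1 + γ j / 2)
      (t := t) (w := fun j => γ j * (p j : ℝ) / 6) (c := 1 / N) (by positivity)
      (fun j => by linarith [hγ j]) (fun j => mul_nonneg (hγ j).le (by have := hpw j; positivity))
      (fun j => ?_) (fun j => by have := hγ j; positivity) htle
    · calc (N : ℝ) * D ≤ N * (1 / N * ((∏ j, (1 + γ j / 2)) * ∏ j, (1 + γ j * (p j : ℝ) / 6))) :=
            mul_le_mul_of_nonneg_left this hN'.le
        _ = _ := by field_simp
    · have h4 : (1 : ℝ) ≤ (p j : ℝ) ^ g j := one_le_pow₀ (by exact_mod_cast (hp j).one_le)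
      have h5 : 1 / (6 * (p j : ℝ) ^ g j) ≤ 1 / 2 :=
        one_div_le_one_div_of_le (by norm_num) (by linarith)
      have := mul_le_mul_of_nonneg_left h5 (hγ j).le
      rw [ht]; simp only; linarith
  have h4 := double_sum_prod_levels_le hp hinj hγ (b := fun j => 1 + γ j / 3)
    (fun j => by have := hγ j; positivity) g hN
  rw [h2]
  have hb0 : 0 ≤ ∏ j, (1 + γ j / 3) := Finset.prod_nonneg fun j _ => by have := hγ j; positivity
  have h5 : ∏ j, (g j * (γ j * (((min (p j) N : ℕ) : ℝ) ^ 2 / 6)) + (1 + γ j / 3)) -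
      ∏ j, (1 + γ j / 3) ≤
      ∏ j, (1 + γ j * Real.log N * ((p j : ℝ) ^ 2 / Real.log (p j))) := by
    -- For `N = 1` there are no levels and the logarithm vanishes, so this bound reads `0 ≤ 1`.
    rcases Nat.lt_or_ge 1 N with h | h
    · refine (sub_le_self _ hb0).trans (Finset.prod_le_prod (fun j _ => ?_) fun j _ => ?_)
      · have := hγ j; positivity
      · have := mul_le_mul_of_nonneg_left (clog_mul_min_sq_le (hp j).two_le h) (hγ j).le
        rw [hg]; simp only; linarith
    · have : N = 1 := le_antisymm h hN
      subst this
      simp [hg]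
  linarith

/-! ### The mean square error -/

theorem lastCell_nonneg (p L m : ℕ) : 0 ≤ lastCell p L m := by
  unfold lastCell; split_ifs <;> norm_num

theorem finInv_le_one {p : ℕ} (hp : 0 < p) (L m : ℕ) : finInv p L m ≤ 1 := by
  have := finInv_add_le_one hp L m
  have : 0 < 1 / (p : ℝ) ^ L := by positivity
  linarith

/-- The residue class, modulo `p ^ L`, of the `p`-adic integer belonging to the shift `t`. -/
noncomputable def cellIndex (p L : ℕ) (t : ℝ) : ℕ := digitRev p L ⌊t * (p : ℝ) ^ L⌋₊

theorem integrable_comp_cellIndex {p : ℕ} (hp : 0 < p) (L : ℕ) (h : ℕ → ℝ) :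
    Integrable (fun t => h (cellIndex p L t)) unitMeas := by
  refine Integrable.of_bound (C := ∑ a ∈ Finset.range (p ^ L), |h a|) ?_ ?_
  · refine Measurable.aestronglyMeasurable ?_
    have h1 : Measurable fun i : ℕ => h (digitRev p L i) := measurable_from_top
    exact h1.comp (Nat.measurable_floor.comp (by fun_prop))
  · refine Eventually.of_forall fun t => ?_
    exact Finset.single_le_sum (f := fun a => |h a|) (fun a _ => abs_nonneg _)
      (Finset.mem_range.2 (digitRev_lt hp L _))

section Average

variable {s : ℕ} {p : Fin s → ℕ}

theorem integrable_prod_cellIndex (hp : ∀ j, 0 < p j) (L : ℕ) (u : Finset (Fin s))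
    (h : Fin s → ℕ → ℝ) :
    Integrable (fun σ : Fin s → ℝ => ∏ j ∈ u, h j (cellIndex (p j) L (σ j)))
      (Measure.pi fun _ => unitMeas) := by
  have h1 : (fun σ : Fin s → ℝ => ∏ j ∈ u, h j (cellIndex (p j) L (σ j))) =
      fun σ => ∏ j, (fun t => if j ∈ u then h j (cellIndex (p j) L t) else 1) (σ j) := by
    funext σ; simp
  rw [h1]
  refine Integrable.fintype_prod
    (f := fun j t => if j ∈ u then h j (cellIndex (p j) L t) else 1)
    (μ := fun _ => unitMeas) fun j => ?_
  by_cases hj : j ∈ u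
  · simpa [hj] using integrable_comp_cellIndex (hp j) L (h j)
  · simp [hj]

theorem integral_prod_cellIndex (hp : ∀ j, 0 < p j) (L : ℕ) (u : Finset (Fin s))
    (h : Fin s → ℕ → ℝ) :
    ∫ σ : Fin s → ℝ, ∏ j ∈ u, h j (cellIndex (p j) L (σ j)) ∂(Measure.pi fun _ => unitMeas) =
      ∏ j ∈ u, (∑ a ∈ Finset.range (p j ^ L), h j a) / (p j : ℝ) ^ L := by
  have h1 := integral_prod_coe u fun j t => h j (cellIndex (p j) L t)
  have h2 : ∀ σ : Fin s → ℝ, ∏ j : u, h j (cellIndex (p j) L (σ j)) =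
      ∏ j ∈ u, h j (cellIndex (p j) L (σ j)) := fun σ =>
    Finset.prod_coe_sort u fun j => h j (cellIndex (p j) L (σ j))
  simp_rw [h2] at h1
  rw [h1, ← Finset.prod_coe_sort u]
  exact Finset.prod_congr rfl fun j _ => integral_comp_digitRev_floor (hp j) L (h j)

variable [∀ j, Fact (p j).Prime]

/-- An upper bound for the squared worst-case error that depends only on the first `L` digits of
the shift. -/
noncomputable def cellBound (p : Fin s → ℕ) (γ : Fin s → ℝ) (N L : ℕ) (σ : Fin s → ℝ) : ℝ :=
  ∑ u : Finset (Fin s), (∏ j ∈ u, γ j) * ((∏ _j ∈ u, (1 / 3 : ℝ)) -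
    2 / N * ∑ n ∈ Finset.range N,
      ∏ j ∈ u, (1 - (finInv (p j) L (n + cellIndex (p j) L (σ j)) + 1 / (p j : ℝ) ^ L) ^ 2) / 2 +
    1 / (N : ℝ) ^ 2 * ∑ n ∈ Finset.range N, ∑ m ∈ Finset.range N, ∏ j ∈ u,
      (1 - max (finInv (p j) L (n + cellIndex (p j) L (σ j)) -
          lastCell (p j) L (n + cellIndex (p j) L (σ j)))
        (finInv (p j) L (m + cellIndex (p j) L (σ j)) -
          lastCell (p j) L (m + cellIndex (p j) L (σ j)))))

/-- Both position-dependent terms decrease in the points once their signs are separated: the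
subtracted cross term takes the upper ends of the enclosure, the added `1 - max` term the lower
ends. -/
theorem sum_integral_localDisc_le_cellBound {γ : Fin s → ℝ} (hγ : ∀ j, 0 < γ j) (N L : ℕ)
    (σ : Fin s → ℝ) :
    ∑ u : Finset (Fin s), (∏ j ∈ u, γ j) *
      ∫ x, localDisc u (shiftedHalton p σ) N x ^ 2 ∂(Measure.pi fun _ => unitMeas) ≤
      cellBound p γ N L σ := by
  have hp : ∀ j, 0 < p j := fun j => (Fact.out : (p j).Prime).pos
  have hS : ∀ n j, shiftedHalton p σ n j ∈ Set.Ico (0 : ℝ) 1 := fun n j => padicShift_mem_Ico _ _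
  have hB : ∀ n j, _ := fun n j => padicShift_radicalInverse_bounds (p := p j) n L (σ j)
  refine Finset.sum_le_sum fun u _ => ?_
  rw [integral_localDisc_sq u hS]
  have hγu : 0 ≤ ∏ j ∈ u, γ j := Finset.prod_nonneg fun j _ => (hγ j).le
  refine mul_le_mul_of_nonneg_left (add_le_add (sub_le_sub_left ?_ _) ?_) hγu
  · refine mul_le_mul_of_nonneg_left (Finset.sum_le_sum fun n _ => ?_) (by positivity)
    refine Finset.prod_le_prod (fun j _ => ?_) fun j _ => ?_
    · have h1 := finInv_add_le_one (hp j) L (n + cellIndex (p j) L (σ j))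
      have h2 := finInv_nonneg (p j) L (n + cellIndex (p j) L (σ j))
      have h3 : 0 ≤ 1 / (p j : ℝ) ^ L := by positivity
      have : (finInv (p j) L (n + cellIndex (p j) L (σ j)) + 1 / (p j : ℝ) ^ L) ^ 2 ≤ 1 :=
        pow_le_one₀ (by linarith) h1
      linarith
    · have h1 := pow_le_pow_left₀ (hS n j).1 (hB n j).2 2
      have : shiftedHalton p σ n j ^ 2 ≤
        (finInv (p j) L (n + cellIndex (p j) L (σ j)) + 1 / (p j : ℝ) ^ L) ^ 2 := h1
      linarith
  · refine mul_le_mul_of_nonneg_left (Finset.sum_le_sum fun n _ => Finset.sum_le_sum fun m _ => ?_)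
      (by positivity)
    refine Finset.prod_le_prod (fun j _ => ?_) fun j _ => ?_
    · exact sub_nonneg.2 (max_le (hS n j).2.le (hS m j).2.le)
    · exact sub_le_sub_left (max_le_max (hB n j).1 (hB m j).1) _

theorem integral_cellBound_le {γ : Fin s → ℝ} (hγ : ∀ j, 0 < γ j) {N L : ℕ} {g : Fin s → ℕ}
    (hg : ∀ j, N ≤ p j ^ g j) (hgL : ∀ j, g j ≤ L) :
    Integrable (cellBound p γ N L) (Measure.pi fun _ => unitMeas) ∧
    ∫ σ, cellBound p γ N L σ ∂(Measure.pi fun _ => unitMeas) ≤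
      ∑ u : Finset (Fin s), (∏ j ∈ u, γ j) * ((∏ _j ∈ u, (1 / 3 : ℝ)) -
        2 / N * ∑ _n ∈ Finset.range N,
          ∏ j ∈ u, (1 - (1 + 1 / (p j : ℝ) ^ L) * (2 + 1 / (p j : ℝ) ^ L) / 6) / 2 +
        1 / (N : ℝ) ^ 2 * ∑ n ∈ Finset.range N, ∑ m ∈ Finset.range N, ∏ j ∈ u,
          (1 / 2 - halfDist (p j) (g j) ((n : ℤ) - m) + 5 / 2 * (1 / (p j : ℝ) ^ L))) := by
  have hp : ∀ j, 0 < p j := fun j => (Fact.out : (p j).Prime).pos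
  set c : ℕ → Fin s → ℕ → ℝ := fun n j a =>
    (1 - (finInv (p j) L (n + a) + 1 / (p j : ℝ) ^ L) ^ 2) / 2 with hc
  set d : ℕ → ℕ → Fin s → ℕ → ℝ := fun n m j a =>
    1 - max (finInv (p j) L (n + a) - lastCell (p j) L (n + a))
        (finInv (p j) L (m + a) - lastCell (p j) L (m + a)) with hd
  have i1 : ∀ u n, Integrable (fun σ : Fin s → ℝ => ∏ j ∈ u, c n j (cellIndex (p j) L (σ j)))
      (Measure.pi fun _ => unitMeas) := fun u n => integrable_prod_cellIndex hp L u (c n)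
  have i2 : ∀ u n m, Integrable
      (fun σ : Fin s → ℝ => ∏ j ∈ u, d n m j (cellIndex (p j) L (σ j)))
      (Measure.pi fun _ => unitMeas) := fun u n m => integrable_prod_cellIndex hp L u (d n m)
  have i3 : ∀ u, Integrable (fun σ : Fin s → ℝ => 2 / (N : ℝ) * ∑ n ∈ Finset.range N,
      ∏ j ∈ u, c n j (cellIndex (p j) L (σ j))) (Measure.pi fun _ => unitMeas) := fun u =>
    (integrable_finsetSum _ fun n _ => i1 u n).const_mul _
  have i4 : ∀ u, Integrable (fun σ : Fin s → ℝ => 1 / (N : ℝ) ^ 2 * ∑ n ∈ Finset.range N,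
      ∑ m ∈ Finset.range N, ∏ j ∈ u, d n m j (cellIndex (p j) L (σ j)))
      (Measure.pi fun _ => unitMeas) := fun u =>
    (integrable_finsetSum _ fun n _ => integrable_finsetSum _ fun m _ => i2 u n m).const_mul _
  have i5 : ∀ u : Finset (Fin s), Integrable (fun σ : Fin s → ℝ => (∏ _j ∈ u, (1 / 3 : ℝ)) -
      2 / (N : ℝ) * ∑ n ∈ Finset.range N, ∏ j ∈ u, c n j (cellIndex (p j) L (σ j)))
      (Measure.pi fun _ => unitMeas) := fun u => (integrable_const _).sub (i3 u)
  have i6 : ∀ u ∈ (Finset.univ : Finset (Finset (Fin s))), Integrable (fun σ : Fin s → ℝ =>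
      (∏ j ∈ u, γ j) * ((∏ _j ∈ u, (1 / 3 : ℝ)) -
      2 / (N : ℝ) * ∑ n ∈ Finset.range N, ∏ j ∈ u, c n j (cellIndex (p j) L (σ j)) +
      1 / (N : ℝ) ^ 2 * ∑ n ∈ Finset.range N,
      ∑ m ∈ Finset.range N, ∏ j ∈ u, d n m j (cellIndex (p j) L (σ j))))
      (Measure.pi fun _ => unitMeas) := fun u _ => ((i5 u).add (i4 u)).const_mul _
  refine ⟨integrable_finsetSum _ i6, ?_⟩
  change ∫ σ : Fin s → ℝ, ∑ u : Finset (Fin s), (∏ j ∈ u, γ j) * ((∏ _j ∈ u, (1 / 3 : ℝ)) -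
      2 / (N : ℝ) * ∑ n ∈ Finset.range N, ∏ j ∈ u, c n j (cellIndex (p j) L (σ j)) +
      1 / (N : ℝ) ^ 2 * ∑ n ∈ Finset.range N,
      ∑ m ∈ Finset.range N, ∏ j ∈ u, d n m j (cellIndex (p j) L (σ j)))
      ∂(Measure.pi fun _ => unitMeas) ≤ _
  rw [integral_finsetSum _ i6]
  refine Finset.sum_le_sum fun u _ => ?_
  rw [integral_const_mul, integral_add (i5 u) (i4 u), integral_sub (integrable_const _) (i3 u),
    integral_const_mul, integral_const_mul, integral_finsetSum _ fun n _ => i1 u n,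
    integral_finsetSum _ fun n _ => integrable_finsetSum _ fun m _ => i2 u n m]
  have hγu : 0 ≤ ∏ j ∈ u, γ j := Finset.prod_nonneg fun j _ => (hγ j).le
  refine mul_le_mul_of_nonneg_left (add_le_add (le_of_eq ?_) ?_) hγu
  · congr 1
    · simp
    · congr 1
      refine Finset.sum_congr rfl fun n _ => ?_
      rw [integral_prod_cellIndex hp L u (c n)]
      exact Finset.prod_congr rfl fun j _ => sum_one_sub_sq (hp j) L n
  · refine mul_le_mul_of_nonneg_left (Finset.sum_le_sum fun n hn => ?_) (by positivity)
    rw [integral_finsetSum _ fun m _ => i2 u n m]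
    refine Finset.sum_le_sum fun m hm => ?_
    rw [Finset.mem_range] at hn hm
    rw [integral_prod_cellIndex hp L u (d n m)]
    refine Finset.prod_le_prod (fun j _ => ?_) fun j _ => ?_
    · refine div_nonneg (Finset.sum_nonneg fun a _ => sub_nonneg.2 (max_le ?_ ?_)) (by positivity)
      · linarith [finInv_le_one (hp j) L (n + a), lastCell_nonneg (p j) L (n + a)]
      · linarith [finInv_le_one (hp j) L (m + a), lastCell_nonneg (p j) L (m + a)]
    · have h1 : |(n : ℤ) - m| < (p j : ℤ) ^ g j := by
        have : (N : ℤ) ≤ (p j : ℤ) ^ g j := by exact_mod_cast hg j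
        rw [abs_lt]; constructor <;> omega
      rw [← halfDist_eq_of_le (hp j) (hgL j) h1]
      exact sum_one_sub_max_le (hp j) L n m

theorem rmsError_sq (γ : Fin s → ℝ) (N : ℕ) :
    rmsError p γ N ^ 2 = ∫⁻ σ, worstCaseError γ (shiftedHalton p σ) N ^ 2
      ∂(Measure.pi fun _ => unitMeas) := by
  rw [rmsError, restrict_Ico_eq_pi, ← ENNReal.rpow_natCast, ← ENNReal.rpow_mul]
  norm_num

theorem sum_prod_mul_prod_eq (u v : Fin s → ℝ) :
    ∑ t : Finset (Fin s), (∏ j ∈ t, u j) * ∏ j ∈ t, v j = ∏ j, (1 + u j * v j) := by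
  rw [Finset.prod_one_add, Finset.powerset_univ]
  simp_rw [Finset.prod_mul_distrib]

/-- The limit `L → ∞` of the cell bounds. The mean error does not depend on `L`, so it suffices that
the bound is a continuous function `Φ` of the cell lengths `p_j^(-L)`. -/
theorem rmsError_sq_le_kernel {γ : Fin s → ℝ} (hγ : ∀ j, 0 < γ j) {N : ℕ} (hN : 1 ≤ N)
    {g : Fin s → ℕ} (hg : ∀ j, N ≤ p j ^ g j) :
    rmsError p γ N ^ 2 ≤ ENNReal.ofReal (1 / (N : ℝ) ^ 2 *
      (∑ n ∈ Finset.range N, ∑ m ∈ Finset.range N,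
        ∏ j, (1 + γ j * (1 / 2 - halfDist (p j) (g j) ((n : ℤ) - m))) -
        (N : ℝ) ^ 2 * ∏ j, (1 + γ j / 3))) := by
  have hN' : (N : ℝ) ≠ 0 := by positivity
  set Φ : (Fin s → ℝ) → ℝ := fun e =>
      ∑ u : Finset (Fin s), (∏ j ∈ u, γ j) * ((∏ _j ∈ u, (1 / 3 : ℝ)) -
        2 / N * ∑ _n ∈ Finset.range N, ∏ j ∈ u, (1 - (1 + e j) * (2 + e j) / 6) / 2 +
        1 / (N : ℝ) ^ 2 * ∑ n ∈ Finset.range N, ∑ m ∈ Finset.range N, ∏ j ∈ u,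
          (1 / 2 - halfDist (p j) (g j) ((n : ℤ) - m) + 5 / 2 * e j)) with hΦ
  have hcont : Continuous Φ := by fun_prop
  have hlim : Tendsto (fun L : ℕ => ENNReal.ofReal (Φ fun j => 1 / (p j : ℝ) ^ L)) atTop
      (𝓝 (ENNReal.ofReal (Φ 0))) := by
    refine ENNReal.tendsto_ofReal ((hcont.tendsto 0).comp ?_)
    rw [tendsto_pi_nhds]
    intro j
    have hp1 : (1 : ℝ) < p j := by exact_mod_cast (Fact.out : (p j).Prime).one_lt
    simpa [Function.comp_def] using
      tendsto_inv_atTop_zero.comp (tendsto_pow_atTop_atTop_of_one_lt hp1)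
  have h0 : Φ 0 = 1 / (N : ℝ) ^ 2 *
      (∑ n ∈ Finset.range N, ∑ m ∈ Finset.range N,
        ∏ j, (1 + γ j * (1 / 2 - halfDist (p j) (g j) ((n : ℤ) - m))) -
        (N : ℝ) ^ 2 * ∏ j, (1 + γ j / 3)) := by
    have h1 : ∏ j, (1 + γ j / 3) =
        ∑ u : Finset (Fin s), (∏ j ∈ u, γ j) * ∏ _j ∈ u, (1 / 3 : ℝ) := by
      rw [sum_prod_mul_prod_eq]
      exact Finset.prod_congr rfl fun j _ => by ring
    simp_rw [← sum_prod_mul_prod_eq]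
    rw [h1, mul_sub, ← mul_assoc, one_div_mul_cancel (pow_ne_zero 2 hN'), one_mul,
      Finset.sum_congr rfl fun n _ => Finset.sum_comm, Finset.sum_comm, Finset.mul_sum,
      ← Finset.sum_sub_distrib]
    refine Finset.sum_congr rfl fun u _ => ?_
    -- At zero cell length the cross term and the constant term have the same product `∏ 1/3`, with
    -- coefficients `-2` and `1`; together they give the subtracted term.
    have h2 : (1 - (2 : ℝ) / 6) / 2 = 1 / 3 := by norm_num
    simp only [Pi.zero_apply, mul_zero, add_zero, one_mul, h2, Finset.sum_const, Finset.card_range,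
      nsmul_eq_mul]
    simp_rw [← Finset.mul_sum]
    field_simp
    ring
  rw [← h0]
  refine ge_of_tendsto hlim ?_
  filter_upwards [eventually_ge_atTop (Finset.univ.sup g)] with L hL
  have hgL : ∀ j, g j ≤ L := fun j => (Finset.le_sup (Finset.mem_univ j)).trans hL
  obtain ⟨hint, hle⟩ := integral_cellBound_le hγ hg hgL
  have hpos : ∀ σ, 0 ≤ cellBound p γ N L σ := fun σ =>
    (Finset.sum_nonneg fun u _ => mul_nonneg (Finset.prod_nonneg fun j _ => (hγ j).le)
      (integral_nonneg fun x => sq_nonneg _)).trans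
      (sum_integral_localDisc_le_cellBound hγ N L σ)
  rw [rmsError_sq]
  calc ∫⁻ σ, worstCaseError γ (shiftedHalton p σ) N ^ 2 ∂(Measure.pi fun _ => unitMeas)
      ≤ ∫⁻ σ, ENNReal.ofReal (cellBound p γ N L σ) ∂(Measure.pi fun _ => unitMeas) := by
        refine lintegral_mono fun σ => ?_
        exact (worstCaseError_sq_le hγ (fun n j => padicShift_mem_Ico _ _) N).trans
          (ENNReal.ofReal_le_ofReal (sum_integral_localDisc_le_cellBound hγ N L σ))
    _ = ENNReal.ofReal (∫ σ, cellBound p γ N L σ ∂(Measure.pi fun _ => unitMeas)) :=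
        (ofReal_integral_eq_lintegral_ofReal hint (Eventually.of_forall hpos)).symm
    _ ≤ _ := ENNReal.ofReal_le_ofReal hle

theorem rmsError_sq_le (hinj : Function.Injective p) {γ : Fin s → ℝ} (hγ : ∀ j, 0 < γ j) {N : ℕ}
    (hN : 1 ≤ N) :
    rmsError p γ N ^ 2 ≤ ENNReal.ofReal ((1 / (N : ℝ) ^ 2) *
      ((∏ j, (1 + γ j * Real.log N * ((p j : ℝ) ^ 2 / Real.log (p j)))) +
        (∏ j, (1 + γ j / 2)) * ∏ j, (1 + γ j * (p j : ℝ) / 6))) := by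
  have hp : ∀ j, (p j).Prime := fun j => Fact.out
  refine (rmsError_sq_le_kernel hγ hN (g := fun j => Nat.clog (p j) N)
    fun j => Nat.le_pow_clog (hp j).one_lt N).trans (ENNReal.ofReal_le_ofReal ?_)
  exact mul_le_mul_of_nonneg_left (double_sum_prod_kernel_le hp hinj hγ hN) (by positivity)

end Average

/-! ### Tractability -/

theorem prod_one_add_le_exp_tsum {x : ℕ → ℝ} (hx : ∀ j, 0 ≤ x j) (hs : Summable x) (s : ℕ) :
    ∏ j ∈ Finset.range s, (1 + x j) ≤ Real.exp (∑' j, x j) := by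
  calc ∏ j ∈ Finset.range s, (1 + x j) ≤ ∏ j ∈ Finset.range s, Real.exp (x j) :=
        Finset.prod_le_prod (fun j _ => by linarith [hx j]) fun j _ => by
          linarith [Real.add_one_le_exp (x j)]
    _ = Real.exp (∑ j ∈ Finset.range s, x j) := (Real.exp_sum _ _).symm
    _ ≤ _ := Real.exp_le_exp.2 (hs.sum_le_tsum _ fun j _ => hx j)

/-- Each of the head (indices below `J`) and the tail contributes `N^δ`, whence the exponent `2δ`;
the square root in the final error bound halves it. -/
theorem exists_prod_one_add_log_le {x : ℕ → ℝ} (hx : ∀ j, 0 ≤ x j) (hs : Summable x) {δ : ℝ}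
    (hδ : 0 < δ) : ∃ C : ℝ, 0 < C ∧ ∀ s N : ℕ, 1 ≤ N →
      ∏ j ∈ Finset.range s, (1 + x j * Real.log N) ≤ C * (N : ℝ) ^ (2 * δ) := by
  obtain ⟨J, hJ⟩ : ∃ J, ∑' i, x (i + J) ≤ δ :=
    ((tendsto_sum_nat_add x).eventually (ge_mem_nhds hδ)).exists
  -- Each of the `J` head factors costs `N^ε`, in total at most `N^δ`; the `+ 1` covers `J = 0`.
  set ε := δ / (J + 1) with hε
  have hεpos : 0 < ε := by positivity
  refine ⟨∏ j ∈ Finset.range J, (1 + x j / ε),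
    Finset.prod_pos fun j _ => by have := hx j; positivity, fun s N hN => ?_⟩
  have hN' : (1 : ℝ) ≤ N := by exact_mod_cast hN
  have hlog : 0 ≤ Real.log N := Real.log_nonneg hN'
  have hge : ∀ j, 1 ≤ 1 + x j * Real.log N := fun j => by
    have := mul_nonneg (hx j) hlog; linarith
  have hNp : (0 : ℝ) < N := by linarith
  have h1 : ∏ j ∈ Finset.range s, (1 + x j * Real.log N) ≤
      ∏ j ∈ Finset.range (J + s), (1 + x j * Real.log N) := by
    rw [← Finset.prod_range_mul_prod_Ico _ (Nat.le_add_left s J)]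
    refine le_mul_of_one_le_right (Finset.prod_nonneg fun j _ => by linarith [hge j]) ?_
    calc (1 : ℝ) = ∏ _j ∈ Finset.Ico s (J + s), (1 : ℝ) := by simp
      _ ≤ _ := Finset.prod_le_prod (fun _ _ => zero_le_one) fun j _ => hge j
  have h2 : ∏ j ∈ Finset.range J, (1 + x j * Real.log N) ≤
      (∏ j ∈ Finset.range J, (1 + x j / ε)) * (N : ℝ) ^ δ := by
    have h3 : ∏ j ∈ Finset.range J, (1 + x j * Real.log N) ≤
        ∏ j ∈ Finset.range J, ((1 + x j / ε) * (N : ℝ) ^ ε) := by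
      refine Finset.prod_le_prod (fun j _ => by linarith [hge j]) fun j _ => ?_
      have h4 : Real.log N ≤ (N : ℝ) ^ ε / ε := Real.log_le_rpow_div hNp.le hεpos
      have h5 : 1 ≤ (N : ℝ) ^ ε := Real.one_le_rpow hN' hεpos.le
      have h6 := mul_le_mul_of_nonneg_left h4 (hx j)
      calc 1 + x j * Real.log N ≤ (N : ℝ) ^ ε + x j * ((N : ℝ) ^ ε / ε) := by linarith
        _ = _ := by ring
    refine h3.trans ?_
    rw [Finset.prod_mul_distrib, Finset.prod_const, Finset.card_range, ← Real.rpow_natCast,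
      ← Real.rpow_mul hNp.le]
    refine mul_le_mul_of_nonneg_left (Real.rpow_le_rpow_of_exponent_le hN' ?_)
      (Finset.prod_nonneg fun j _ => by have := hx j; positivity)
    rw [hε, div_mul_eq_mul_div, div_le_iff₀ (by positivity)]
    nlinarith
  have h3 : ∏ i ∈ Finset.range s, (1 + x (J + i) * Real.log N) ≤ (N : ℝ) ^ δ := by
    have h4 : Summable fun i => x (i + J) := (summable_nat_add_iff J).2 hs
    have h5 := prod_one_add_le_exp_tsum (x := fun i => x (i + J) * Real.log N)
      (fun i => mul_nonneg (hx _) hlog) (h4.mul_right _) s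
    rw [tsum_mul_right] at h5
    simp_rw [add_comm J]
    refine h5.trans ?_
    rw [Real.rpow_def_of_pos hNp, Real.exp_le_exp, mul_comm]
    exact mul_le_mul_of_nonneg_left hJ hlog
  calc _ ≤ _ := h1
    _ = (∏ j ∈ Finset.range J, (1 + x j * Real.log N)) *
          ∏ i ∈ Finset.range s, (1 + x (J + i) * Real.log N) := Finset.prod_range_add _ _ _
    _ ≤ (∏ j ∈ Finset.range J, (1 + x j / ε)) * (N : ℝ) ^ δ * (N : ℝ) ^ δ :=
        mul_le_mul h2 h3 (Finset.prod_nonneg fun j _ => by linarith [hge (J + j)])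
          (mul_nonneg (Finset.prod_nonneg fun j _ => by have := hx j; positivity) (by positivity))
    _ = _ := by rw [mul_assoc, ← Real.rpow_add hNp, two_mul]

theorem exists_rmsError_le (p : ℕ → ℕ) [∀ j, Fact (p j).Prime] (hinj : Function.Injective p)
    {γ : ℕ → ℝ} (hγ : ∀ j, 0 < γ j)
    (hs : Summable fun j => γ j * ((p j : ℝ) ^ 2 / Real.log (p j))) {δ : ℝ} (hδ : 0 < δ) :
    ∃ C : ℝ, 0 < C ∧ ∀ s N : ℕ, 1 ≤ N →
      rmsError (fun j : Fin s => p j) (fun j : Fin s => γ j) N ≤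
        ENNReal.ofReal (C / (N : ℝ) ^ (1 - δ)) := by
  set x : ℕ → ℝ := fun j => γ j * ((p j : ℝ) ^ 2 / Real.log (p j)) with hx
  have hp2 : ∀ j, (2 : ℝ) ≤ p j := fun j => by
    exact_mod_cast (Fact.out : (p j).Prime).two_le
  have hple : ∀ j, (p j : ℝ) ≤ (p j : ℝ) ^ 2 / Real.log (p j) := by
    intro j
    have h2 := hp2 j
    rw [le_div_iff₀ (Real.log_pos (by linarith)), pow_two]
    exact mul_le_mul_of_nonneg_left ((Real.log_le_sub_one_of_pos (by linarith)).trans (by linarith))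
      (by linarith)
  have hx1 : ∀ j, γ j / 2 ≤ x j := fun j => by
    have := mul_le_mul_of_nonneg_left ((hp2 j).trans (hple j)) (hγ j).le
    simp only [hx]; linarith [hγ j]
  have hx2 : ∀ j, γ j * (p j : ℝ) / 6 ≤ x j := fun j => by
    have := mul_le_mul_of_nonneg_left (hple j) (hγ j).le
    have h3 : 0 ≤ γ j * p j := mul_nonneg (hγ j).le (by positivity)
    simp only [hx]; linarith
  have hx0 : ∀ j, 0 ≤ x j := fun j => le_trans (by have := hγ j; positivity) (hx1 j)
  obtain ⟨C₁, hC₁, hb⟩ := exists_prod_one_add_log_le hx0 hs hδ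
  set E := Real.exp (∑' j, x j) with hE
  have hEpos : 0 < E := Real.exp_pos _
  -- `C₁` controls the logarithmic product. Each of the two products without `N` is at most `E`,
  -- because `γ_j/2` and `γ_j p_j/6` are both at most `x j`.
  refine ⟨√(C₁ + E * E), Real.sqrt_pos.2 (by positivity), fun s N hN => ?_⟩
  have hN' : (1 : ℝ) ≤ N := by exact_mod_cast hN
  have hNp : (0 : ℝ) < N := by linarith
  have hinj' : Function.Injective fun j : Fin s => p j := hinj.comp Fin.val_injective
  have h1 := rmsError_sq_le (p := fun j : Fin s => p j) hinj' (γ := fun j : Fin s => γ j)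
    (fun j => hγ j) hN
  have hprod : ∀ f : ℕ → ℝ, (∀ j, 0 ≤ f j) → (∀ j, f j ≤ x j) → ∏ j : Fin s, (1 + f j) ≤ E := by
    intro f hf0 hf
    rw [Fin.prod_univ_eq_prod_range fun j => 1 + f j]
    refine le_trans ?_ (prod_one_add_le_exp_tsum hx0 hs s)
    exact Finset.prod_le_prod (fun j _ => by linarith [hf0 j]) fun j _ => by linarith [hf j]
  have h2 := hprod (fun j => γ j / 2) (fun j => by have := hγ j; positivity) hx1
  have h3 := hprod (fun j => γ j * (p j : ℝ) / 6) (fun j => by have := hγ j; positivity) hx2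
  have h4 : ∏ j : Fin s, (1 + γ j * Real.log N * ((p j : ℝ) ^ 2 / Real.log (p j))) ≤
      C₁ * (N : ℝ) ^ (2 * δ) := by
    rw [Fin.prod_univ_eq_prod_range
      fun j => 1 + γ j * Real.log N * ((p j : ℝ) ^ 2 / Real.log (p j))]
    refine le_trans (le_of_eq (Finset.prod_congr rfl fun j _ => ?_)) (hb s N hN)
    simp only [hx]; ring
  have h5 : (1 : ℝ) ≤ (N : ℝ) ^ (2 * δ) := Real.one_le_rpow hN' (by positivity)
  have h6 : (1 / (N : ℝ) ^ 2) *
      ((∏ j : Fin s, (1 + γ j * Real.log N * ((p j : ℝ) ^ 2 / Real.log (p j)))) +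
        (∏ j : Fin s, (1 + γ j / 2)) * ∏ j : Fin s, (1 + γ j * (p j : ℝ) / 6)) ≤
      (√(C₁ + E * E) / (N : ℝ) ^ (1 - δ)) ^ 2 := by
    have h7 : (√(C₁ + E * E) / (N : ℝ) ^ (1 - δ)) ^ 2 =
        1 / (N : ℝ) ^ 2 * ((C₁ + E * E) * (N : ℝ) ^ (2 * δ)) := by
      rw [div_pow, Real.sq_sqrt (by positivity), ← Real.rpow_natCast ((N : ℝ) ^ (1 - δ)),
        ← Real.rpow_mul hNp.le]
      have : (1 - δ) * ((2 : ℕ) : ℝ) = ((2 : ℕ) : ℝ) - 2 * δ := by push_cast; ring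
      rw [this, Real.rpow_sub hNp, Real.rpow_natCast]
      field_simp
    rw [h7]
    refine mul_le_mul_of_nonneg_left ?_ (by positivity)
    have h8 : (∏ j : Fin s, (1 + γ j / 2)) * ∏ j : Fin s, (1 + γ j * (p j : ℝ) / 6) ≤ E * E :=
      mul_le_mul h2 h3 (Finset.prod_nonneg fun j _ => by have := hγ j; positivity) hEpos.le
    have h9 : E * E ≤ E * E * (N : ℝ) ^ (2 * δ) := le_mul_of_one_le_right (by positivity) h5
    linarith
  have h7 := h1.trans (ENNReal.ofReal_le_ofReal h6)
  rw [ENNReal.ofReal_pow (by positivity)] at h7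
  exact (ENNReal.pow_le_pow_left_iff two_ne_zero).1 h7

end PadicHalton

theorem theorem1 :
    (∀ (s : ℕ) (p : Fin s → ℕ) [∀ j, Fact (p j).Prime], Function.Injective p →
      ∀ γ : Fin s → ℝ, (∀ j, 0 < γ j) → ∀ N : ℕ, 1 ≤ N →
        PadicHalton.rmsError p γ N ^ 2 ≤
          ENNReal.ofReal ((1 / (N : ℝ) ^ 2) *
            ((∏ j, (1 + γ j * Real.log N * ((p j : ℝ) ^ 2 / Real.log (p j)))) +
              (∏ j, (1 + γ j / 2)) * ∏ j, (1 + γ j * (p j : ℝ) / 6)))) ∧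
    (∀ (p : ℕ → ℕ) [∀ j, Fact (p j).Prime], Function.Injective p →
      ∀ γ : ℕ → ℝ, (∀ j, 0 < γ j) →
        Summable (fun j => γ j * ((p j : ℝ) ^ 2 / Real.log (p j))) →
        ∀ δ : ℝ, 0 < δ → ∃ C : ℝ, 0 < C ∧ ∀ s N : ℕ, 1 ≤ N →
          PadicHalton.rmsError (fun j : Fin s => p j) (fun j : Fin s => γ j) N ≤
            ENNReal.ofReal (C / (N : ℝ) ^ (1 - δ))) :=
  ⟨fun _ _ _ hinj _ hγ _ hN => PadicHalton.rmsError_sq_le hinj hγ hN,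
    fun p _ hinj _ hγ hs _ hδ => PadicHalton.exists_rmsError_le p hinj hγ hs hδ⟩
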